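/- **Notation.** For $\mathcal A\in\mathbb R^{m\times n\times p}$ ($p\ge1$) let $A^{(1)},\dots,A^{(p)}$ be its frontal slices, $\|\mathcal A\|_F$ the square root of the sum of the squares of its entries, and $\bar A^{(1)},\dots,\bar A^{(p)}\in\mathbb C^{m\times n}$ the frontal slices of its (unnormalized) discrete Fourier transform along the third dimension. Let $\mathrm{bcirc}(\mathcal A)\in\mathbb R^{mp\times np}$ be the block circulant matrix with first block column $A^{(1)},\dots,A^{(p)}$. The T-product, transpose and identity tensor are determined by $\mathrm{bcirc}(\mathcal A*\mathcal B)=\mathrm{bcirc}(\mathcal A)\,\mathrm{bcirc}(\mathcal B)$, $\mathrm{bcirc}(\mathcal A^\top)=\mathrm{bcirc}(\mathcal A)^\top$ and $\mathrm{bcirc}(\mathcal I_{nnp})=I_{np}$. A tensor $\mathcal Q\in\mathbb R^{m\times k\times p}$ is partially orthogonal if $\mathcal Q^\top*\mathcal Q=\mathcal I_{kkp}$; a tensor $\mathcal U\in\mathbb R^{m\times m\times p}$ is orthogonal if $\mathcal U^\top*\mathcal U=\mathcal U*\mathcal U^\top=\mathcal I_{mmp}$. A tensor is f-upper triangular (f-diagonal)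 if each of its frontal slices is upper triangular (diagonal). For $1\le i\le\min\{m,n\}$ let $\mathcal S(i,i,:)$ be the tube of length $p$ whose discrete Fourier transform is $\big(\sigma_i(\bar A^{(1)}),\dots,\sigma_i(\bar A^{(p)})\big)$, where $\sigma_i(M)$ is the $i$th largest singular value of the matrix $M$. The $i$th largest T-singular value of $\mathcal A$ is $\sigma_i(\mathcal A)=\big(\sum_{t=1}^p|\mathcal S(i,i,t)|^2\big)^{1/2}$, and for $j\ge 1$ the squared $j$th tail energy is $\tau_j^2(\mathcal A)=\sum_{j\le i\le\min\{m,n\}}\sigma_i(\mathcal A)^2$ (an empty sum is $0$). A Gaussian random tensor $\mathcal B\in\mathbb R^{n\times k\times p}$ is a random tensor such that the entries of $B^{(1)}$ are independent standard normal variables and the other frontal slices are zero. **Theorem 5.3.** Let $\mathcal A\in\mathbb R^{m\times n\times p}$, let $s\ge0$ be an integer with $s<k-1$, and let $\mathcal B\in\mathbb R^{n\times k\times p}$ be a Gaussian random tensor. Let $\mathcal Y=\mathcal A*\mathcal B$, and let $\mathcal Q\in\mathbb R^{m\times k\times p}$ be a (measurable) random tensor such that almost surely $\mathcal Q$ is partially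 orthogonal and $\mathcal Y=\mathcal Q*\mathcal R$ for some f-upper triangular $\mathcal R\in\mathbb R^{k\times k\times p}$ (in particular $k\le m$). Then $\|\mathcal A-\mathcal Q*\mathcal Q^\top*\mathcal A\|_F^2$ is integrable and $$\mathbb E_{\mathcal B}\,\|\mathcal A-\mathcal Q*\mathcal Q^\top*\mathcal A\|_F^2\ \le\ \Big(1+\frac{s}{k-s-1}\Big)\,\tau_{s+1}^2(\mathcal A).$$ Moreover, for every T-SVD $\mathcal A=\mathcal U*\mathcal S*\mathcal V^\top$ (with $\mathcal U\in\mathbb R^{m\times m\times p}$, $\mathcal V\in\mathbb R^{n\times n\times p}$ orthogonal and $\mathcal S\in\mathbb R^{m\times n\times p}$ f-diagonal), whatever the order of the diagonal tubes of $\mathcal S$, the same bound holds with $\tau_{s+1}^2(\mathcal A)$ replaced by $\sum_{s+1\le i\le\min\{m,n\}}\sum_{t=1}^p\mathcal S(i,i,t)^2$. -/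

import Mathlib

open MeasureTheory ProbabilityTheory

noncomputable section

namespace TSketch

/-- Real third order tensors of size `m × n × p`.  The third index runs over `ZMod p`; the `t`-th
frontal slice (`t = 1, …, p`) is the one with index `t - 1` modulo `p`, so the first frontal slice
has index `0`. -/
abbrev Tensor (m n p : ℕ) : Type := Fin m → Fin n → ZMod p → ℝ

variable {m n r k p : ℕ}

/-- The block circulant matrix of a tensor: its block in position `(a, b)` is the frontal slice with
index `a - b` modulo `p`. -/
def bcirc (A : Tensor m n p) : Matrix (ZMod p × Fin m) (ZMod p × Fin n) ℝ :=
  Matrix.of fun a b => A a.2 b.2 (a.1 - b.1)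

/-- The frontal slices of a tensor stacked in one block column. -/
def unfold (A : Tensor m n p) : Matrix (ZMod p × Fin m) (Fin n) ℝ :=
  Matrix.of fun a j => A a.2 j a.1

/-- The inverse of `unfold`. -/
def fold (M : Matrix (ZMod p × Fin m) (Fin n) ℝ) : Tensor m n p :=
  fun i j t => M (t, i) j

/-- The T-product `A * B = fold (bcirc A · unfold B)`. -/
def tProd [NeZero p] (A : Tensor m r p) (B : Tensor r n p) : Tensor m n p :=
  fold (bcirc A * unfold B)

/-- The transpose of a tensor: the tensor whose block circulant matrix is the transpose of that
of `A` (see `bcirc_tTranspose`). -/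
def tTranspose (A : Tensor m n p) : Tensor n m p :=
  fun j i t => A i j (-t)

theorem bcirc_tTranspose (A : Tensor m n p) : bcirc (tTranspose A) = (bcirc A).transpose := by
  ext a b
  simp [bcirc, tTranspose]

/-- The identity tensor: the first frontal slice is the identity matrix, the others vanish. -/
def tId (n p : ℕ) : Tensor n n p :=
  fun i j t => if i = j ∧ t = 0 then 1 else 0

/-- `Qᵀ * Q` is the identity tensor. -/
def IsPartiallyOrthogonal [NeZero p] (Q : Tensor m n p) : Prop :=
  tProd (tTranspose Q) Q = tId n p

/-- `Qᵀ` is the two-sided inverse of `Q`. -/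
def IsOrthogonal [NeZero p] (Q : Tensor n n p) : Prop :=
  tProd (tTranspose Q) Q = tId n p ∧ tProd Q (tTranspose Q) = tId n p

/-- Every frontal slice is upper triangular. -/
def IsFUpperTriangular (R : Tensor n n p) : Prop :=
  ∀ i j t, j < i → R i j t = 0

/-- Every frontal slice is diagonal. -/
def IsFDiagonal (S : Tensor m n p) : Prop :=
  ∀ (i : Fin m) (j : Fin n) (t : ZMod p), (i : ℕ) ≠ (j : ℕ) → S i j t = 0

/-- `Q` is the orthonormal factor of a T-orthogonal-triangular factorization `Y = Q * R`. -/
def IsTQRFactor [NeZero p] (Y Q : Tensor m k p) : Prop :=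
  IsPartiallyOrthogonal Q ∧ ∃ R : Tensor k k p, IsFUpperTriangular R ∧ Y = tProd Q R

/-- `A = U * S * Vᵀ` is a T-SVD of `A`. -/
def IsTSVD [NeZero p] (A : Tensor m n p)
    (U : Tensor m m p) (S : Tensor m n p) (V : Tensor n n p) : Prop :=
  IsOrthogonal U ∧ IsOrthogonal V ∧ IsFDiagonal S ∧ A = tProd (tProd U S) (tTranspose V)

/-- The Frobenius norm of a tensor. -/
def frobeniusNorm [NeZero p] (A : Tensor m n p) : ℝ :=
  √(∑ i, ∑ j, ∑ t, A i j t ^ 2)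

/-- The frontal slice with index `t` of the discrete Fourier transform of `A` along the third
dimension. -/
def fourierSlice [NeZero p] (A : Tensor m n p) (t : ZMod p) : Matrix (Fin m) (Fin n) ℂ :=
  Matrix.of fun i j => ZMod.dft (fun u => (A i j u : ℂ)) t

/-- The `(i+1)`-st singular tube of `A`: the tube whose discrete Fourier transform consists of the
`(i+1)`-st largest singular values of the Fourier slices of `A`.  These tubes are the diagonal tubes
`S(i+1, i+1, :)` of the T-SVD `A = U * S * Vᵀ` that is obtained by the discrete Fourier transform
from decreasingly ordered singular value decompositions of the Fourier slices. -/
def singularTube [NeZero p] (A : Tensor m n p) (i : ℕ) : ZMod p → ℂ :=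
  ZMod.dft.symm fun t =>
    ((LinearMap.singularValues (Matrix.toEuclideanLin (fourierSlice A t)) i : ℝ) : ℂ)

/-- The `(i+1)`-st largest T-singular value of `A`: the Euclidean norm of the `(i+1)`-st singular
tube. -/
def tSingularValue [NeZero p] (A : Tensor m n p) (i : ℕ) : ℝ :=
  √(∑ t, ‖singularTube A i t‖ ^ 2)

/-- The square of the `j`-th tail energy, the sum of the squares of the `i`-th largest T-singular
values over all `i` with `j ≤ i ≤ min m n`. -/
def tailEnergySq [NeZero p] (A : Tensor m n p) (j : ℕ) : ℝ :=
  ∑ i : Fin (min m n) with j ≤ i.val + 1, tSingularValue A i ^ 2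

/-- The sum of the squared Euclidean norms of the diagonal tubes `S(i, i, :)`, over all `i` with
`j ≤ i ≤ min m n`. -/
def diagTailSq [NeZero p] (S : Tensor m n p) (j : ℕ) : ℝ :=
  ∑ i : Fin (min m n) with j ≤ i.val + 1,
    ∑ t, S (Fin.castLE (min_le_left m n) i) (Fin.castLE (min_le_right m n) i) t ^ 2

/-- The random tensor `B` is a Gaussian random tensor: the entries of its first frontal slice are
independent standard normal random variables, and its other frontal slices are zero. -/
structure IsGaussianTensor {Ω : Type*} [MeasurableSpace Ω] (P : Measure Ω)
    (B : Ω → Tensor n k p) : Prop where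
  hasLaw : ∀ i j, HasLaw (fun ω => B ω i j 0) (gaussianReal 0 1) P
  indep : iIndepFun (fun (e : Fin n × Fin k) ω => B ω e.1 e.2 0) P
  eq_zero : ∀ᵐ ω ∂P, ∀ i j t, t ≠ 0 → B ω i j t = 0

end TSketch

end

/-! The discrete Fourier transform turns T-products into slicewise matrix products, transposes into
adjoints, and the squared Frobenius norm into `p⁻¹` times the sum over the slices. Only the first
frontal slice of `B` is nonzero, so all its Fourier slices equal one real Gaussian matrix `g`. It
therefore suffices to treat a single complex matrix `A`. The projection error of `A` is at most `‖A
(1 - g X)‖` for every `X`, even one depending on `g` (`frobSq_sub_proj_le`).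

Since `g` is real and the right singular vectors of `A` are complex, rotating `g` by them does not
preserve its law, and the classical splitting into independent Gaussian blocks is not available.
Instead let `W` have orthonormal columns spanning the tail directions, put `R = (g gᵀ + η + W
diag(h)⁻¹ Wᴴ)⁻¹` and take `X = gᵀ R`. Then `1 - g X = η R + W diag(h)⁻¹ Wᴴ R`, and two facts carry
the estimate.

Expected trace (`integral_trace_regInv_le`): Stein's identity applied to `R C g` with `C = 1 - W
Wᴴ`, combined with the pointwise `trace_bounds`, gives `(k - 1 - s - η ∑ h / 2) E tr R ≤ s + (k - 1)
∑ h`.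

Sign symmetry (`integral_regInv_mul_gram_eq_zero`): by Takagi's factorization `Wᵀ W` may be taken
diagonal. Real reflections then fix one column of `W` and negate the others, so the off-diagonal
entries of `Wᴴ R R W` have mean zero. Only diagonal terms survive, and the main error is at most `c
E tr R` whenever `‖A W e_a‖² ≤ c h_a` for all `a`.

With `h_a = (‖A W e_a‖² + ε) / ε` and `c = ε`, letting `η → 0` and then `ε → 0` yields the factor
`(k - 1) / (k - 1 - s) = 1 + s / (k - s - 1)`. -/

set_option linter.unusedSectionVars false

/-! ### Gaussian integration by parts -/

theorem hasDerivAt_gaussianPDFReal_zero_one (x : ℝ) :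
    HasDerivAt (gaussianPDFReal 0 1) (-x * gaussianPDFReal 0 1 x) x := by
  have h : HasDerivAt (fun y : ℝ => -(y - 0) ^ 2 / (2 * ((1 : NNReal) : ℝ))) (-x) x := by
    have := (((hasDerivAt_id x).sub_const 0).pow 2).neg.div_const (2 * ((1 : NNReal) : ℝ))
    refine this.congr_deriv ?_
    simp
    ring
  have h2 := h.exp.const_mul ((√(2 * Real.pi * ((1 : NNReal) : ℝ)))⁻¹)
  rw [gaussianPDFReal_def]
  refine h2.congr_deriv ?_
  ring

theorem integrable_gaussianReal_iff {f : ℝ → ℂ} :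
    Integrable f (gaussianReal 0 1) ↔
      Integrable (fun x => f x * (gaussianPDFReal 0 1 x : ℂ)) := by
  rw [gaussianReal_of_var_ne_zero _ one_ne_zero,
    integrable_withDensity_iff_integrable_smul' (measurable_gaussianPDF 0 1)
      (Filter.Eventually.of_forall fun x => ENNReal.ofReal_lt_top)]
  refine integrable_congr (Filter.Eventually.of_forall fun x => ?_)
  simp [toReal_gaussianPDF, mul_comm]

/-- Integration by parts against the density, whose derivative is `-x` times itself. Integrability
of all three products makes the boundary terms vanish. -/
theorem integral_gaussianReal_mul_eq_integral_deriv {g g' : ℝ → ℂ}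
    (hg : ∀ x, HasDerivAt g (g' x) x) (h0 : Integrable g (gaussianReal 0 1))
    (h1 : Integrable (fun x : ℝ => (x : ℂ) * g x) (gaussianReal 0 1))
    (h2 : Integrable g' (gaussianReal 0 1)) :
    ∫ x : ℝ, (x : ℂ) * g x ∂(gaussianReal 0 1) = ∫ x, g' x ∂(gaussianReal 0 1) := by
  rw [integrable_gaussianReal_iff] at h0 h1 h2
  have key := integral_mul_deriv_eq_deriv_mul_of_integrable (A := ℂ) (u := g) (u' := g')
    (v := fun x => (gaussianPDFReal 0 1 x : ℂ))
    (v' := fun x => ((-x * gaussianPDFReal 0 1 x : ℝ) : ℂ))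
    (fun x _ => hg x) (fun x _ => (hasDerivAt_gaussianPDFReal_zero_one x).ofReal_comp)
    (by
      refine h1.neg.congr (Filter.Eventually.of_forall fun x => ?_)
      simp only [Pi.neg_apply, Pi.mul_apply]; push_cast; ring)
    h2 h0
  rw [integral_gaussianReal_eq_integral_smul one_ne_zero,
    integral_gaussianReal_eq_integral_smul one_ne_zero]
  rw [← neg_eq_iff_eq_neg, ← integral_neg] at key
  simp only [Complex.real_smul]
  refine Eq.trans (integral_congr_ae (Filter.Eventually.of_forall fun x => ?_))
    (key.trans (integral_congr_ae (Filter.Eventually.of_forall fun x => ?_)))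
  · push_cast; ring
  · simp only; ring

/-- The law of a family of independent standard normal variables. -/
noncomputable def stdNormalPi (ι : Type*) [Fintype ι] : Measure (ι → ℝ) :=
  Measure.pi fun _ => gaussianReal 0 1

instance {ι : Type*} [Fintype ι] : IsProbabilityMeasure (stdNormalPi ι) := by
  unfold stdNormalPi; infer_instance

section
variable {ι : Type*} [Fintype ι] [DecidableEq ι]

/-- Resampling one coordinate independently leaves the product law unchanged. This isolates a single
coordinate for Fubini without splitting the index type. -/
theorem measurePreserving_update_stdNormalPi (e : ι) :
    MeasurePreserving (fun q : ℝ × (ι → ℝ) => Function.update q.2 e q.1)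
      ((gaussianReal 0 1).prod (stdNormalPi ι)) (stdNormalPi ι) := by
  have hm : Measurable (fun q : ℝ × (ι → ℝ) => Function.update q.2 e q.1) := by
    refine measurable_pi_lambda _ fun i => ?_
    by_cases h : i = e
    · subst h; simpa using measurable_fst
    · simp only [Function.update_of_ne h]; fun_prop
  refine ⟨hm, ?_⟩
  refine (Measure.pi_eq fun s hs => ?_).symm
  rw [Measure.map_apply hm (MeasurableSet.univ_pi hs)]
  have : (fun q : ℝ × (ι → ℝ) => Function.update q.2 e q.1) ⁻¹' (Set.univ.pi s)
      = s e ×ˢ (Set.univ.pi (Function.update s e Set.univ)) := by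
    ext q
    simp only [Set.mem_preimage, Set.mem_pi, Set.mem_univ, true_imp_iff, Set.mem_prod]
    constructor
    · intro h
      refine ⟨by simpa using h e, fun i => ?_⟩
      by_cases hi : i = e
      · subst hi; simp
      · simpa [hi] using h i
    · rintro ⟨h1, h2⟩ i
      by_cases hi : i = e
      · subst hi; simpa using h1
      · simpa [hi] using h2 i
  rw [this, Measure.prod_prod, stdNormalPi, Measure.pi_pi]
  rw [← Finset.mul_prod_erase Finset.univ _ (Finset.mem_univ e),
    ← Finset.mul_prod_erase Finset.univ (fun i => gaussianReal 0 1 (s i)) (Finset.mem_univ e)]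
  simp only [Function.update_self, measure_univ, one_mul]
  congr 1
  refine Finset.prod_congr rfl fun i hi => ?_
  rw [Function.update_of_ne (Finset.ne_of_mem_erase hi)]

/-- Stein's identity. -/
theorem integral_stdNormalPi_mul_eq_integral_deriv (e : ι) {f f' : (ι → ℝ) → ℂ}
    (hf : ∀ G, HasDerivAt (fun t => f (Function.update G e t)) (f' G) (G e))
    (h0 : Integrable f (stdNormalPi ι))
    (h1 : Integrable (fun G => (G e : ℂ) * f G) (stdNormalPi ι))
    (h2 : Integrable f' (stdNormalPi ι)) :
    ∫ G, (G e : ℂ) * f G ∂(stdNormalPi ι) = ∫ G, f' G ∂(stdNormalPi ι) := by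
  have hT := measurePreserving_update_stdNormalPi e
  have i0 := (hT.integrable_comp h0.1).2 h0
  have i1 := (hT.integrable_comp h1.1).2 h1
  have i2 := (hT.integrable_comp h2.1).2 h2
  have e1 := integral_map hT.measurable.aemeasurable (by rw [hT.map_eq]; exact h1.1)
  have e2 := integral_map hT.measurable.aemeasurable (by rw [hT.map_eq]; exact h2.1)
  rw [hT.map_eq] at e1 e2
  simp only [Function.comp_def] at i0 i1 i2
  -- The resampled coordinate is integrated first, which reduces the claim to the one-dimensional
  -- identity for almost every choice of the others.
  rw [e1, e2, integral_prod_symm _ i1, integral_prod_symm _ i2]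
  refine integral_congr_ae ?_
  filter_upwards [i0.prod_left_ae, i1.prod_left_ae, i2.prod_left_ae] with G g0 g1 g2
  simp only [Function.update_self] at g0 g1 g2 ⊢
  refine integral_gaussianReal_mul_eq_integral_deriv (fun x => ?_) g0 g1 g2
  have := hf (Function.update G e x)
  simpa using this

theorem integrable_sq_stdNormalPi (e : ι) :
    Integrable (fun G : ι → ℝ => G e ^ 2) (stdNormalPi ι) := by
  have h : Integrable (fun x : ℝ => x ^ 2) (gaussianReal 0 1) :=
    (memLp_id_gaussianReal (μ := 0) (v := 1) 2).integrable_sq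
  exact integrable_comp_eval (μ := fun _ : ι => gaussianReal 0 1) (i := e) h

/-- Functions of at most quadratic growth are integrable. -/
theorem integrable_stdNormalPi_of_le {f : (ι → ℝ) → ℂ} (hf : Continuous f) (c : ℝ)
    (h : ∀ G, ‖f G‖ ≤ c * (1 + ∑ e, G e ^ 2)) : Integrable f (stdNormalPi ι) := by
  have : Integrable (fun G : ι → ℝ => c * (1 + ∑ e, G e ^ 2)) (stdNormalPi ι) :=
    ((integrable_const _).add
      (integrable_finsetSum _ fun e _ => integrable_sq_stdNormalPi e)).const_mul c
  exact this.mono' hf.aestronglyMeasurable (Filter.Eventually.of_forall h)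

/-! ### Orthogonal invariance of the Gaussian law -/

theorem measurePreserving_linearIsometry_stdNormalPi
    (f : EuclideanSpace ℝ ι ≃ₗᵢ[ℝ] EuclideanSpace ℝ ι) :
    MeasurePreserving (fun G : ι → ℝ => WithLp.ofLp (f (WithLp.toLp 2 G)))
      (stdNormalPi ι) (stdNormalPi ι) := by
  refine ⟨by fun_prop, ?_⟩
  have h := map_pi_eq_stdGaussian (ι := ι)
  change Measure.map (WithLp.toLp 2) (stdNormalPi ι) = _ at h
  have h2 := stdGaussian_map f
  rw [← h, Measure.map_map (by fun_prop) (by fun_prop)] at h2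
  have h3 := congrArg (Measure.map WithLp.ofLp) h2
  rw [Measure.map_map (by fun_prop) (by fun_prop), h,
    ← h, Measure.map_map (by fun_prop) (by fun_prop)] at h3
  simp only [Function.comp_def] at h3
  rw [h3]
  exact Measure.map_id

end

section
variable {ι κ : Type*} [Fintype ι] [Fintype κ] [DecidableEq ι] [DecidableEq κ]

/-- The law of a standard Gaussian matrix is invariant under multiplication by an orthogonal
matrix. -/
theorem measurePreserving_orthogonal_mul (O : Matrix ι ι ℝ) (hO : O.transpose * O = 1) :
    MeasurePreserving (fun (G : ι × κ → ℝ) (e : ι × κ) => ∑ j, O e.1 j * G (j, e.2))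
      (stdNormalPi (ι × κ)) (stdNormalPi (ι × κ)) := by
  let L : EuclideanSpace ℝ (ι × κ) →ₗ[ℝ] EuclideanSpace ℝ (ι × κ) :=
    { toFun := fun G => WithLp.toLp 2 fun e => ∑ j, O e.1 j * G (j, e.2)
      map_add' := fun x y => by
        ext e; simp [mul_add, Finset.sum_add_distrib]
      map_smul' := fun c x => by
        ext e; simp [Finset.mul_sum]; refine Finset.sum_congr rfl fun j _ => by ring }
  have hL : ∀ G, ‖L G‖ = ‖G‖ := by
    intro G
    rw [← sq_eq_sq₀ (norm_nonneg _) (norm_nonneg _), EuclideanSpace.real_norm_sq_eq,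
      EuclideanSpace.real_norm_sq_eq, Fintype.sum_prod_type_right, Fintype.sum_prod_type_right]
    refine Finset.sum_congr rfl fun a _ => ?_
    have h1 : ∀ i, L G (i, a) = O.mulVec (fun j => G (j, a)) i := fun i => rfl
    have h2 : ∑ i, L G (i, a) ^ 2 = dotProduct (O.mulVec (fun j => G (j, a)))
        (O.mulVec (fun j => G (j, a))) := by
      simp [dotProduct, h1, sq]
    rw [h2, Matrix.dotProduct_mulVec, ← Matrix.mulVec_transpose, Matrix.mulVec_mulVec, hO,
      Matrix.one_mulVec]
    simp [dotProduct, sq]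
  let f := (LinearIsometry.mk L hL).toLinearIsometryEquiv rfl
  exact measurePreserving_linearIsometry_stdNormalPi f

end

/-! ### Frobenius norms, traces and the regularized inverse -/

section
open Matrix
open scoped ComplexOrder

variable {ι κ α μ : Type*} [Fintype ι] [Fintype κ] [Fintype α] [Fintype μ]
  [DecidableEq ι] [DecidableEq κ] [DecidableEq α] [DecidableEq μ]

/-- The square of the Frobenius norm of a complex matrix. -/
noncomputable def frobSq (Z : Matrix ι κ ℂ) : ℝ := ∑ i, ∑ j, ‖Z i j‖ ^ 2

theorem frobSq_nonneg (Z : Matrix ι κ ℂ) : 0 ≤ frobSq Z :=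
  Finset.sum_nonneg fun _ _ => Finset.sum_nonneg fun _ _ => sq_nonneg _

theorem norm_sq_le_frobSq (Z : Matrix ι κ ℂ) (i : ι) (j : κ) : ‖Z i j‖ ^ 2 ≤ frobSq Z :=
  (Finset.single_le_sum (f := fun j => ‖Z i j‖ ^ 2) (fun _ _ => sq_nonneg _)
    (Finset.mem_univ j)).trans
  (Finset.single_le_sum (f := fun i => ∑ j, ‖Z i j‖ ^ 2)
    (fun _ _ => Finset.sum_nonneg fun _ _ => sq_nonneg _) (Finset.mem_univ i))

theorem trace_conjTranspose_mul_self_eq_frobSq (Z : Matrix ι κ ℂ) :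
    (Zᴴ * Z).trace = (frobSq Z : ℂ) := by
  simp only [trace, diag, mul_apply, conjTranspose_apply, frobSq]
  push_cast
  rw [Finset.sum_comm]
  refine Finset.sum_congr rfl fun i _ => Finset.sum_congr rfl fun j _ => ?_
  rw [← Complex.conj_mul']
  rfl

theorem frobSq_conjTranspose (Z : Matrix ι κ ℂ) : frobSq Zᴴ = frobSq Z := by
  simp only [frobSq, conjTranspose_apply, norm_star]
  rw [Finset.sum_comm]

theorem frobSq_transpose (Z : Matrix ι κ ℂ) : frobSq Zᵀ = frobSq Z := by
  simp only [frobSq, transpose_apply]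
  rw [Finset.sum_comm]

theorem norm_trace_mul_sq_le (X : Matrix ι κ ℂ) (Y : Matrix κ ι ℂ) :
    ‖(X * Y).trace‖ ^ 2 ≤ frobSq X * frobSq Y := by
  have h1 : ‖(X * Y).trace‖ ≤ ∑ q : ι × κ, ‖X q.1 q.2‖ * ‖Y q.2 q.1‖ := by
    rw [Fintype.sum_prod_type]
    simp only [trace, diag, mul_apply]
    refine (norm_sum_le _ _).trans (Finset.sum_le_sum fun i _ => ?_)
    refine (norm_sum_le _ _).trans (Finset.sum_le_sum fun j _ => ?_)
    rw [norm_mul]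
  have h2 := Finset.sum_mul_sq_le_sq_mul_sq Finset.univ
    (fun q : ι × κ => ‖X q.1 q.2‖) (fun q => ‖Y q.2 q.1‖)
  rw [Fintype.sum_prod_type (f := fun q : ι × κ => ‖X q.1 q.2‖ ^ 2),
    Fintype.sum_prod_type_right (f := fun q : ι × κ => ‖Y q.2 q.1‖ ^ 2)] at h2
  exact (pow_le_pow_left₀ (norm_nonneg _) h1 2).trans h2

theorem frobSq_mul_le (X : Matrix ι κ ℂ) (Y : Matrix κ μ ℂ) :
    frobSq (X * Y) ≤ frobSq X * frobSq Y := by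
  have h : ∀ i j, ‖(X * Y) i j‖ ^ 2 ≤ (∑ l, ‖X i l‖ ^ 2) * ∑ l, ‖Y l j‖ ^ 2 := by
    intro i j
    refine le_trans ?_ (Finset.sum_mul_sq_le_sq_mul_sq Finset.univ
      (fun l => ‖X i l‖) (fun l => ‖Y l j‖))
    refine pow_le_pow_left₀ (norm_nonneg _) ?_ 2
    rw [mul_apply]
    refine (norm_sum_le _ _).trans (Finset.sum_le_sum fun j _ => ?_)
    rw [norm_mul]
  refine (Finset.sum_le_sum fun i _ => Finset.sum_le_sum fun j _ => h i j).trans ?_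
  simp only [← Finset.mul_sum, ← Finset.sum_mul, frobSq]
  rw [Finset.sum_comm (f := fun j l => ‖Y l j‖ ^ 2)]

/-- Weighted Young inequality: the main error term keeps a factor close to `1`, while the large
factor falls on the term that vanishes with `η`. -/
theorem frobSq_add_le (X Y : Matrix ι κ ℂ) {ε : ℝ} (hε : 0 < ε) :
    frobSq (X + Y) ≤ (1 + ε) * frobSq X + (1 + 1 / ε) * frobSq Y := by
  simp only [frobSq, Finset.mul_sum, ← Finset.sum_add_distrib]
  refine Finset.sum_le_sum fun i _ => Finset.sum_le_sum fun j _ => ?_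
  refine (pow_le_pow_left₀ (norm_nonneg _) (norm_add_le (X i j) (Y i j)) 2).trans ?_
  set a := ‖X i j‖
  set b := ‖Y i j‖
  have : (1 + ε) * a ^ 2 + (1 + 1 / ε) * b ^ 2 - (a + b) ^ 2 = (ε * a - b) ^ 2 / ε := by
    field_simp; ring
  have h2 : 0 ≤ (ε * a - b) ^ 2 / ε := by positivity
  linarith

theorem frobSq_smul (c : ℂ) (X : Matrix ι κ ℂ) : frobSq (c • X) = ‖c‖ ^ 2 * frobSq X := by
  simp [frobSq, Finset.mul_sum, mul_pow]

/-- Each diagonal entry satisfies `|∑ z²| ≤ ∑ |z|²`. Stein's identity for a real `g` produces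
transposes rather than adjoints; this compares the two kinds of trace. -/
theorem norm_trace_diagonal_mul_transpose_mul_self_le (Z : Matrix ι α ℂ) (θ : α → ℂ)
    (c : α → ℝ) (hθ : ∀ a, ‖θ a‖ ≤ c a) :
    (diagonal θ * (Zᵀ * Z)).trace.re ≤ (diagonal (fun a => (c a : ℂ)) * (Zᴴ * Z)).trace.re := by
  simp only [trace, diag, diagonal_mul, Complex.re_sum]
  simp only [mul_apply, transpose_apply, conjTranspose_apply]
  refine Finset.sum_le_sum fun a _ => ?_
  rw [Complex.re_ofReal_mul, Complex.re_sum]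
  refine (Complex.re_le_norm _).trans ?_
  rw [norm_mul]
  refine mul_le_mul (hθ a) ?_ (norm_nonneg _) ((norm_nonneg _).trans (hθ a))
  refine (norm_sum_le _ _).trans (Finset.sum_le_sum fun i _ => ?_)
  have : star (Z i a) * Z i a = ((‖Z i a‖ ^ 2 : ℝ) : ℂ) := by
    push_cast; rw [← Complex.conj_mul']; rfl
  rw [this, Complex.ofReal_re, norm_mul, sq]

theorem re_trace_transpose_mul_self_le (Z : Matrix ι α ℂ) :
    (Zᵀ * Z).trace.re ≤ frobSq Z := by
  have h := norm_trace_diagonal_mul_transpose_mul_self_le Z (fun _ => 1) (fun _ => 1)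
    (fun _ => by simp)
  have e : (Zᴴ * Z).trace.re = frobSq Z := by
    rw [trace_conjTranspose_mul_self_eq_frobSq, Complex.ofReal_re]
  simpa [e] using h

/-- `g gᵀ + η + W diag(h)⁻¹ Wᴴ`. -/
noncomputable def regGram (g : Matrix ι κ ℂ) (W : Matrix ι α ℂ) (h : α → ℝ) (η : ℝ) : Matrix ι ι ℂ :=
  g * gᵀ + (η : ℂ) • (1 : Matrix ι ι ℂ) + W * diagonal (fun a => ((h a)⁻¹ : ℂ)) * Wᴴ

variable {g : Matrix ι κ ℂ} {W : Matrix ι α ℂ} {h : α → ℝ} {η : ℝ}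

theorem posDef_regGram (hg : gᴴ = gᵀ) (hh : ∀ a, 0 < h a) (hη : 0 < η) :
    (regGram g W h η).PosDef := by
  unfold regGram
  refine PosDef.add_posSemidef (PosDef.posSemidef_add ?_ ?_) ?_
  · rw [← hg]; exact posSemidef_self_mul_conjTranspose g
  · exact PosDef.one.smul (by exact_mod_cast hη)
  · refine PosSemidef.mul_mul_conjTranspose_same (PosSemidef.diagonal fun a => ?_) W
    simp only [Pi.zero_apply]
    have := (hh a).le
    rw [← Complex.ofReal_inv]
    exact_mod_cast inv_nonneg.2 this

/-- The inverse of the regularized Gram matrix. -/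
noncomputable def regInv (g : Matrix ι κ ℂ) (W : Matrix ι α ℂ) (h : α → ℝ) (η : ℝ) : Matrix ι ι ℂ :=
  (regGram g W h η)⁻¹

theorem posDef_regInv (hg : gᴴ = gᵀ) (hh : ∀ a, 0 < h a) (hη : 0 < η) :
    (regInv g W h η).PosDef := (posDef_regGram hg hh hη).inv

theorem regGram_mul_regInv (hg : gᴴ = gᵀ) (hh : ∀ a, 0 < h a) (hη : 0 < η) :
    regGram g W h η * regInv g W h η = 1 :=
  mul_nonsing_inv _ ((isUnit_iff_isUnit_det _).1 (posDef_regGram hg hh hη).isUnit)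

theorem regInv_mul_regGram (hg : gᴴ = gᵀ) (hh : ∀ a, 0 < h a) (hη : 0 < η) :
    regInv g W h η * regGram g W h η = 1 :=
  nonsing_inv_mul _ ((isUnit_iff_isUnit_det _).1 (posDef_regGram hg hh hη).isUnit)

theorem conjTranspose_regInv (hg : gᴴ = gᵀ) (hh : ∀ a, 0 < h a) (hη : 0 < η) :
    (regInv g W h η)ᴴ = regInv g W h η := (posDef_regInv hg hh hη).isHermitian

/-- The trace of `R = R (g gᵀ + η + W diag(h)⁻¹ Wᴴ) R`, term by term. -/
theorem re_trace_regInv (hg : gᴴ = gᵀ) (hh : ∀ a, 0 < h a) (hη : 0 < η) :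
    (regInv g W h η).trace.re = frobSq (regInv g W h η * g) + η * frobSq (regInv g W h η)
      + (diagonal (fun a => ((h a)⁻¹ : ℂ)) *
        ((regInv g W h η * W)ᴴ * (regInv g W h η * W))).trace.re := by
  have hR := conjTranspose_regInv (W := W) hg hh hη
  have h1 := regInv_mul_regGram (W := W) hg hh hη
  generalize hRd : regInv g W h η = R at *
  have h2 : R = R * regGram g W h η * R := by rw [h1, one_mul]
  have e1 : (R * (g * gᵀ) * R).trace = frobSq (R * g) := by
    rw [← frobSq_conjTranspose, ← trace_conjTranspose_mul_self_eq_frobSq]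
    have hg2 : gᵀᴴ = g := by rw [← hg, conjTranspose_conjTranspose]
    simp only [conjTranspose_mul, hR, hg, hg2, Matrix.mul_assoc]
  have e2 : (R * ((η : ℂ) • (1 : Matrix ι ι ℂ)) * R).trace = (η : ℂ) * frobSq R := by
    rw [← trace_conjTranspose_mul_self_eq_frobSq, hR]
    simp
  have e3 : (R * (W * diagonal (fun a => ((h a)⁻¹ : ℂ)) * Wᴴ) * R).trace
      = (diagonal (fun a => ((h a)⁻¹ : ℂ)) * ((R * W)ᴴ * (R * W))).trace := by
    rw [conjTranspose_mul, hR]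
    rw [show R * (W * diagonal (fun a => ((h a)⁻¹ : ℂ)) * Wᴴ) * R
      = (R * W) * (diagonal (fun a => ((h a)⁻¹ : ℂ)) * (Wᴴ * R)) by simp only [Matrix.mul_assoc]]
    rw [trace_mul_comm]
    simp only [Matrix.mul_assoc]
  have h3 := congrArg trace h2
  unfold regGram at h3
  rw [Matrix.mul_add, Matrix.mul_add, Matrix.add_mul, Matrix.add_mul, trace_add, trace_add,
    e1, e2, e3] at h3
  have h4 := congrArg Complex.re h3
  rw [Complex.add_re, Complex.add_re, Complex.ofReal_re, Complex.re_ofReal_mul,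
    Complex.ofReal_re] at h4
  exact h4

theorem re_trace_diagonal_mul_gram (c : α → ℝ) (Z : Matrix ι α ℂ) :
    (diagonal (fun a => (c a : ℂ)) * (Zᴴ * Z)).trace.re = ∑ a, c a * ∑ i, ‖Z i a‖ ^ 2 := by
  simp only [trace, diag, diagonal_mul, Complex.re_sum, Complex.re_ofReal_mul]
  refine Finset.sum_congr rfl fun a _ => ?_
  congr 1
  simp only [mul_apply, conjTranspose_apply, Complex.re_sum]
  refine Finset.sum_congr rfl fun i _ => ?_
  have : star (Z i a) * Z i a = ((‖Z i a‖ ^ 2 : ℝ) : ℂ) := by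
    push_cast; rw [← Complex.conj_mul']; rfl
  rw [this, Complex.ofReal_re]

theorem sum_inv_mul_le_re_trace_regInv (hg : gᴴ = gᵀ) (hh : ∀ a, 0 < h a) (hη : 0 < η) :
    ∑ a, (h a)⁻¹ * ∑ i, ‖(regInv g W h η * W) i a‖ ^ 2 ≤ (regInv g W h η).trace.re := by
  have h0 := re_trace_regInv (W := W) hg hh hη
  have h1 := re_trace_diagonal_mul_gram (fun a => (h a)⁻¹) (regInv g W h η * W)
  push_cast at h1
  rw [h1] at h0
  have := frobSq_nonneg (regInv g W h η * g)
  have := mul_nonneg hη.le (frobSq_nonneg (regInv g W h η))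
  linarith

theorem eta_mul_frobSq_le (hg : gᴴ = gᵀ) (hh : ∀ a, 0 < h a) (hη : 0 < η) :
    η * frobSq (regInv g W h η) ≤ (regInv g W h η).trace.re := by
  have h0 := re_trace_regInv (W := W) hg hh hη
  have h1 := re_trace_diagonal_mul_gram (fun a => (h a)⁻¹) (regInv g W h η * W)
  push_cast at h1
  rw [h1] at h0
  have := frobSq_nonneg (regInv g W h η * g)
  have : 0 ≤ ∑ a, (h a)⁻¹ * ∑ i, ‖(regInv g W h η * W) i a‖ ^ 2 :=
    Finset.sum_nonneg fun a _ => mul_nonneg (inv_nonneg.2 (hh a).le)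
      (Finset.sum_nonneg fun _ _ => sq_nonneg _)
  linarith

theorem re_trace_regInv_nonneg (hg : gᴴ = gᵀ) (hh : ∀ a, 0 < h a) (hη : 0 < η) :
    0 ≤ (regInv g W h η).trace.re :=
  (mul_nonneg hη.le (frobSq_nonneg _)).trans (eta_mul_frobSq_le hg hh hη)

/-- Cauchy–Schwarz gives `(tr R)² ≤ card ι * ‖R‖²`, and `η ‖R‖² ≤ tr R`. The bound is crude but
uniform in `g`, so that the entries of `R` are bounded and everything below is integrable. -/
theorem re_trace_regInv_le (hg : gᴴ = gᵀ) (hh : ∀ a, 0 < h a) (hη : 0 < η) :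
    (regInv g W h η).trace.re ≤ Fintype.card ι / η := by
  have h0 := eta_mul_frobSq_le (W := W) hg hh hη
  have h1 := norm_trace_mul_sq_le (regInv g W h η) 1
  rw [Matrix.mul_one] at h1
  have h2 : frobSq (1 : Matrix ι ι ℂ) = Fintype.card ι := by
    simp [frobSq, one_apply, apply_ite]
  rw [h2] at h1
  have h3 := Complex.abs_re_le_norm (regInv g W h η).trace
  have h4 : (regInv g W h η).trace.re ^ 2 ≤ ‖(regInv g W h η).trace‖ ^ 2 := by
    rw [← sq_abs]; exact pow_le_pow_left₀ (abs_nonneg _) h3 2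
  rw [le_div_iff₀ hη]
  set x := (regInv g W h η).trace.re
  have h5 : 0 ≤ x := re_trace_regInv_nonneg hg hh hη
  rcases h5.eq_or_lt with h6 | h6
  · rw [← h6]; simp
  · have h7 : x * (x * η) ≤ x * Fintype.card ι := by
      have : (Fintype.card ι : ℝ) ≥ 0 := by positivity
      nlinarith
    exact le_of_mul_le_mul_left h7 h6

theorem norm_regInv_sq_le (hg : gᴴ = gᵀ) (hh : ∀ a, 0 < h a) (hη : 0 < η) (i j : ι) :
    ‖regInv g W h η i j‖ ^ 2 ≤ Fintype.card ι / η / η := by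
  refine (norm_sq_le_frobSq _ i j).trans ?_
  rw [le_div_iff₀ hη, mul_comm]
  exact (eta_mul_frobSq_le hg hh hη).trans (re_trace_regInv_le hg hh hη)

end

/-! ### Deterministic trace bounds for the regularized inverse -/

section
open Matrix
open scoped ComplexOrder

variable {ι κ α : Type*} [Fintype ι] [Fintype κ] [Fintype α]
  [DecidableEq ι] [DecidableEq κ] [DecidableEq α]
  {g : Matrix ι κ ℂ} {W : Matrix ι α ℂ} {h : α → ℝ} {η : ℝ} {d : α → ℂ}

theorem conjTranspose_mul_self_apply_self (Z : Matrix ι α ℂ) (a : α) :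
    (Zᴴ * Z) a a = ((∑ i, ‖Z i a‖ ^ 2 : ℝ) : ℂ) := by
  rw [mul_apply]
  push_cast
  refine Finset.sum_congr rfl fun i _ => ?_
  rw [← Complex.conj_mul']; rfl

open scoped MatrixOrder Matrix.Norms.L2Operator in
theorem exists_eq_conjTranspose_mul_self {M : Matrix ι ι ℂ} (hM : M.PosSemidef) :
    ∃ F : Matrix ι ι ℂ, M = Fᴴ * F := by
  obtain ⟨F, hF⟩ := CStarAlgebra.nonneg_iff_eq_star_mul_self.mp hM.nonneg
  exact ⟨F, hF⟩

theorem norm_le_one_of_transpose_mul_self_eq (hW : Wᴴ * W = 1) (hd : Wᵀ * W = diagonal d)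
    (a : α) : ‖d a‖ ≤ 1 := by
  have h1 : d a = ∑ i, W i a * W i a := by
    have := congrFun (congrFun hd a) a
    rw [diagonal_apply_eq] at this
    rw [← this]; rfl
  have h2 : (∑ i, ‖W i a‖ ^ 2 : ℝ) = 1 := by
    have := congrFun (congrFun hW a) a
    rw [one_apply_eq, mul_apply] at this
    have h3 : ∀ i, Wᴴ a i * W i a = ((‖W i a‖ ^ 2 : ℝ) : ℂ) := fun i => by
      push_cast; rw [← Complex.conj_mul']; rfl
    simp only [h3] at this
    exact_mod_cast this
  rw [h1, ← h2]
  refine (norm_sum_le _ _).trans (Finset.sum_le_sum fun i _ => ?_)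
  rw [norm_mul, sq]

theorem gram_mul_regInv (hg : gᴴ = gᵀ) (hh : ∀ a, 0 < h a) (hη : 0 < η) :
    g * gᵀ * regInv g W h η = 1 - (η : ℂ) • regInv g W h η
      - W * diagonal (fun a => ((h a)⁻¹ : ℂ)) * Wᴴ * regInv g W h η := by
  have h1 := regGram_mul_regInv (W := W) hg hh hη
  rw [← h1]
  conv_rhs => enter [1, 1, 1]; unfold regGram
  rw [Matrix.add_mul, Matrix.add_mul, Matrix.smul_mul, Matrix.one_mul]
  abel

/-- A separate version is needed because `R` is Hermitian but, for complex `W`, in general not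
symmetric. -/
theorem gram_mul_transpose_regInv (hg : gᴴ = gᵀ) (hh : ∀ a, 0 < h a) (hη : 0 < η) :
    g * gᵀ * (regInv g W h η)ᵀ = 1 - (η : ℂ) • (regInv g W h η)ᵀ
      - Wᴴᵀ * diagonal (fun a => ((h a)⁻¹ : ℂ)) * Wᵀ * (regInv g W h η)ᵀ := by
  have h1 := congrArg transpose (regInv_mul_regGram (W := W) hg hh hη)
  rw [transpose_one, transpose_mul] at h1
  rw [← h1]
  conv_rhs => enter [1, 1, 1]; unfold regGram
  simp only [transpose_add, transpose_mul, transpose_smul, transpose_one, transpose_transpose,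
    diagonal_transpose]
  rw [Matrix.add_mul, Matrix.add_mul, Matrix.smul_mul, Matrix.one_mul]
  simp only [Matrix.mul_assoc]
  abel

/-- The negative part of the trace identity has a sign. -/
theorem re_trace_compl_mul_nonneg (hg : gᴴ = gᵀ) (hh : ∀ a, 0 < h a) (hη : 0 < η)
    (hW : Wᴴ * W = 1) (hd : Wᵀ * W = diagonal d) :
    0 ≤ ((1 - W * Wᴴ) * (Wᴴᵀ * diagonal (fun a => ((h a)⁻¹ : ℂ)) * Wᵀ *
      (regInv g W h η)ᵀ * regInv g W h η)).trace.re := by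
  have h1 := gram_mul_transpose_regInv (W := W) hg hh hη
  have h2 := re_trace_regInv (W := W) hg hh hη
  have hd1 := norm_le_one_of_transpose_mul_self_eq hW hd
  generalize regInv g W h η = R at *
  set D : Matrix α α ℂ := diagonal (fun a => ((h a)⁻¹ : ℂ)) with hD
  have e1 : (Wᴴᵀ * D * Wᵀ * Rᵀ * R).trace = R.trace - (η : ℂ) * (Rᵀ * R).trace
      - ((R * g)ᵀ * (R * g)).trace := by
    have h3 : Wᴴᵀ * D * Wᵀ * Rᵀ = 1 - (η : ℂ) • Rᵀ - g * gᵀ * Rᵀ := by rw [h1]; abel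
    rw [h3, Matrix.sub_mul, Matrix.sub_mul, Matrix.one_mul, trace_sub, trace_sub,
      Matrix.smul_mul, trace_smul, smul_eq_mul]
    congr 1
    rw [transpose_mul, Matrix.mul_assoc, Matrix.mul_assoc, trace_mul_comm]
    simp only [Matrix.mul_assoc]
  have e2 : (W * Wᴴ * (Wᴴᵀ * D * Wᵀ * Rᵀ * R)).trace
      = (diagonal (fun a => star (d a) * ((h a)⁻¹ : ℂ)) * ((R * W)ᵀ * (R * W))).trace := by
    have h4 : Wᴴ * Wᴴᵀ = diagonal (star d) := by
      rw [← diagonal_conjTranspose, ← hd, conjTranspose_mul]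
      rfl
    have h5 : diagonal (fun a => star (d a) * ((h a)⁻¹ : ℂ)) = Wᴴ * Wᴴᵀ * D := by
      rw [h4, hD, diagonal_mul_diagonal]
      rfl
    rw [h5, Matrix.mul_assoc, trace_mul_comm, transpose_mul]
    simp only [Matrix.mul_assoc]
  -- Each transposed trace is at most its Hermitian counterpart, the last one because `‖d a‖ ≤ 1`.
  -- By `h2` the Hermitian counterparts add up exactly to the real part of `R.trace`, so the
  -- difference is nonnegative.
  have f1 := re_trace_transpose_mul_self_le R
  have f2 := re_trace_transpose_mul_self_le (R * g)
  have f3 := norm_trace_diagonal_mul_transpose_mul_self_le (R * W)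
    (fun a => star (d a) * ((h a)⁻¹ : ℂ)) (fun a => (h a)⁻¹) (fun a => by
      rw [norm_mul, norm_star, norm_inv, Complex.norm_real, Real.norm_of_nonneg (hh a).le]
      exact mul_le_of_le_one_left (inv_nonneg.2 (hh a).le) (hd1 a))
  rw [Matrix.sub_mul, Matrix.one_mul, trace_sub, e1, e2]
  push_cast at f3
  rw [← hD] at f3
  simp only [Complex.sub_re, Complex.re_ofReal_mul]
  have f4 := mul_le_mul_of_nonneg_left f1 hη.le
  linarith

/-- Pointwise trace bounds for the regularized inverse. -/
theorem trace_bounds (hg : gᴴ = gᵀ) (hh : ∀ a, 0 < h a) (hη : 0 < η)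
    (hW : Wᴴ * W = 1) (hd : Wᵀ * W = diagonal d) :
    ((gᵀ * (regInv g W h η * (1 - W * Wᴴ) * g)).trace
        + (regInv g W h η).trace * (gᵀ * (regInv g W h η * (1 - W * Wᴴ) * g)).trace
        + ((regInv g W h η * g)ᵀ * (regInv g W h η * (1 - W * Wᴴ) * g)).trace).re
      ≤ (1 - W * Wᴴ).trace.re * (1 + (regInv g W h η).trace.re)
        + (regInv g W h η * (1 - W * Wᴴ)).trace.re
        + η * (∑ a, h a) / 2 * (regInv g W h η).trace.re ∧
    (regInv g W h η).trace.re - ∑ a, h a ≤ (regInv g W h η * (1 - W * Wᴴ)).trace.re := by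
  have hpos := (posDef_regInv (W := W) hg hh hη).posSemidef
  have s1 := gram_mul_regInv (W := W) hg hh hη
  have s2 := gram_mul_transpose_regInv (W := W) hg hh hη
  have s3 := re_trace_compl_mul_nonneg hg hh hη hW hd
  have s4 := regInv_mul_regGram (W := W) hg hh hη
  obtain ⟨F, hF⟩ := exists_eq_conjTranspose_mul_self hpos
  generalize regInv g W h η = R at *
  set D : Matrix α α ℂ := diagonal (fun a => ((h a)⁻¹ : ℂ)) with hD
  set C : Matrix ι ι ℂ := 1 - W * Wᴴ with hC
  have hCW : C * W = 0 := by
    rw [hC, Matrix.sub_mul, Matrix.mul_assoc, hW]; simp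
  have hCh : Cᴴ = C := by rw [hC]; simp
  have hCC : C * C = C := by
    conv_lhs => rw [hC, Matrix.mul_sub, Matrix.mul_one, ← Matrix.mul_assoc, ← hC, hCW]
    simp
  have hx : R.trace = (frobSq F : ℂ) := by
    rw [hF, trace_conjTranspose_mul_self_eq_frobSq]
  have hr : (R * C).trace = (frobSq (F * C) : ℂ) := by
    rw [← trace_conjTranspose_mul_self_eq_frobSq, conjTranspose_mul, hCh, hF, ← hCC,
      ← Matrix.mul_assoc, trace_mul_comm, hCC]
    simp only [Matrix.mul_assoc]
  have hr2 : (R * (W * Wᴴ)).trace = (frobSq (F * W) : ℂ) := by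
    rw [← trace_conjTranspose_mul_self_eq_frobSq, conjTranspose_mul, hF,
      ← Matrix.mul_assoc, trace_mul_comm]
    simp only [Matrix.mul_assoc]
  have hsum : frobSq F = frobSq (F * C) + frobSq (F * W) := by
    have : R = R * C + R * (W * Wᴴ) := by rw [hC, ← Matrix.mul_add]; simp
    have := congrArg trace this
    rw [trace_add, hx, hr, hr2] at this
    exact_mod_cast this
  have n1 := frobSq_nonneg (F * C)
  have n2 := frobSq_nonneg (F * W)
  -- Expanding `R = R M R`, with `M` the regularized Gram matrix, shows that each diagonal entry `ρ`
  -- of `Wᴴ R W` satisfies `ρ² / h a ≤ ρ`, hence `ρ ≤ h a`.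
  have hr22 : frobSq (F * W) ≤ ∑ a, h a := by
    have key : ∀ a, (Wᴴ * R * W) a a = ((∑ i, ‖(F * W) i a‖ ^ 2 : ℝ) : ℂ) := by
      intro a
      have : Wᴴ * R * W = (F * W)ᴴ * (F * W) := by
        rw [hF, conjTranspose_mul]; simp only [Matrix.mul_assoc]
      rw [this, conjTranspose_mul_self_apply_self]
    have bound : ∀ a, ∑ i, ‖(F * W) i a‖ ^ 2 ≤ h a := by
      intro a
      set ρ := ∑ i, ‖(F * W) i a‖ ^ 2 with hρ
      have hRh : Rᴴ = R := hpos.1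
      have hg2 : gᵀᴴ = g := by rw [← hg, conjTranspose_conjTranspose]
      have e0 : Wᴴ * R * W = (gᵀ * R * W)ᴴ * (gᵀ * R * W) + (η : ℂ) • ((R * W)ᴴ * (R * W))
          + (Wᴴ * R * W) * D * (Wᴴ * R * W) := by
        have e1 : R = R * regGram g W h η * R := by rw [s4, Matrix.one_mul]
        conv_lhs => rw [e1]
        unfold regGram
        simp only [Matrix.mul_add, Matrix.add_mul, conjTranspose_mul, hRh, hg2, Matrix.mul_assoc,
          Matrix.smul_mul, Matrix.mul_smul, Matrix.one_mul, ← hD]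
      have e2 : ((Wᴴ * R * W) * D * (Wᴴ * R * W)) a a
          = ((∑ b, (h b)⁻¹ * ‖(Wᴴ * R * W) b a‖ ^ 2 : ℝ) : ℂ) := by
        have hTh : (Wᴴ * R * W)ᴴ = Wᴴ * R * W := by
          simp only [conjTranspose_mul, hRh, conjTranspose_conjTranspose, Matrix.mul_assoc]
        generalize Wᴴ * R * W = T at *
        rw [mul_apply]
        push_cast
        refine Finset.sum_congr rfl fun b _ => ?_
        rw [hD, mul_diagonal]
        have : T a b = star (T b a) := by rw [← conjTranspose_apply, hTh]
        rw [this, ← Complex.conj_mul', starRingEnd_apply]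
        ring
      have e3 := congrArg Complex.re (congrFun (congrFun e0 a) a)
      rw [key a, Matrix.add_apply, Matrix.add_apply, e2, Matrix.smul_apply, conjTranspose_mul_self_apply_self,
        conjTranspose_mul_self_apply_self, smul_eq_mul, Complex.add_re, Complex.add_re,
        Complex.re_ofReal_mul, Complex.ofReal_re, Complex.ofReal_re, Complex.ofReal_re,
        Complex.ofReal_re, ← hρ] at e3
      have e4 : (h a)⁻¹ * ‖(Wᴴ * R * W) a a‖ ^ 2
          ≤ ∑ b, (h b)⁻¹ * ‖(Wᴴ * R * W) b a‖ ^ 2 :=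
        Finset.single_le_sum (f := fun b => (h b)⁻¹ * ‖(Wᴴ * R * W) b a‖ ^ 2)
          (fun b _ => mul_nonneg (inv_nonneg.2 (hh b).le) (sq_nonneg _)) (Finset.mem_univ a)
      rw [key a, ← hρ, Complex.norm_real, Real.norm_eq_abs, sq_abs] at e4
      have e5 : 0 ≤ ∑ i, ‖(gᵀ * R * W) i a‖ ^ 2 := Finset.sum_nonneg fun _ _ => sq_nonneg _
      have e6 : 0 ≤ η * ∑ i, ‖(R * W) i a‖ ^ 2 :=
        mul_nonneg hη.le (Finset.sum_nonneg fun _ _ => sq_nonneg _)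
      have e7 : 0 ≤ ρ := Finset.sum_nonneg fun _ _ => sq_nonneg _
      have e8 : (h a)⁻¹ * ρ ^ 2 ≤ ρ := by linarith
      rw [inv_mul_le_iff₀ (hh a)] at e8
      by_contra hlt
      push Not at hlt
      nlinarith [hh a]
    have : frobSq (F * W) = ∑ a, ∑ i, ‖(F * W) i a‖ ^ 2 := by
      rw [frobSq, Finset.sum_comm]
    rw [this]
    exact Finset.sum_le_sum fun a _ => bound a
  -- The `W` term of `g gᵀ R` disappears under the trace because `C W = 0`.
  have t1 : (gᵀ * (R * C * g)).trace = C.trace - (η : ℂ) * (R * C).trace := by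
    rw [trace_mul_comm, Matrix.mul_assoc, trace_mul_comm, ← Matrix.mul_assoc, s1,
      Matrix.sub_mul, Matrix.sub_mul, Matrix.one_mul, trace_sub, trace_sub, Matrix.smul_mul,
      trace_smul, smul_eq_mul]
    rw [show W * D * Wᴴ * R * C = W * (D * Wᴴ * R * C) by simp only [Matrix.mul_assoc],
      trace_mul_comm W]
    rw [show D * Wᴴ * R * C * W = D * Wᴴ * R * (C * W) by simp only [Matrix.mul_assoc], hCW]
    simp
  have t2 : ((R * g)ᵀ * (R * C * g)).trace = (R * C).trace - (η : ℂ) * ((R * C) * Rᵀ).trace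
      - (C * (Wᴴᵀ * D * Wᵀ * Rᵀ * R)).trace := by
    rw [transpose_mul, Matrix.mul_assoc, trace_mul_comm]
    rw [show Rᵀ * (R * C * g) * gᵀ = Rᵀ * (R * C * (g * gᵀ)) by simp only [Matrix.mul_assoc],
      trace_mul_comm]
    rw [show R * C * (g * gᵀ) * Rᵀ = R * C * (g * gᵀ * Rᵀ) by simp only [Matrix.mul_assoc], s2,
      Matrix.mul_sub, Matrix.mul_sub, trace_sub, trace_sub, Matrix.mul_one, Matrix.mul_smul,
      trace_smul, smul_eq_mul]
    congr 1
    rw [Matrix.mul_assoc, trace_mul_comm]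
    simp only [Matrix.mul_assoc]
  -- With `x`, `r`, `w` the squared norms of `F`, `F C`, `F W`, Cauchy–Schwarz gives `x √(r (r + w))
  -- ≤ x (r + w / 2)`. The coefficient of `x r` must be exactly `1`: it cancels against the `-η x r`
  -- coming from `t1`.
  have t3 : ‖((R * C) * Rᵀ).trace‖ ≤ frobSq F * (frobSq (F * C) + frobSq (F * W) / 2) := by
    have b1 := norm_trace_mul_sq_le (R * C) Rᵀ
    have b2 : frobSq (R * C) ≤ frobSq F * frobSq (F * C) := by
      rw [hF, Matrix.mul_assoc]
      have := frobSq_mul_le Fᴴ (F * C)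
      rwa [frobSq_conjTranspose] at this
    have b3 : frobSq Rᵀ ≤ frobSq F * frobSq F := by
      rw [frobSq_transpose, hF]
      have := frobSq_mul_le Fᴴ F
      rwa [frobSq_conjTranspose] at this
    have b0 := frobSq_nonneg F
    have b4 := mul_le_mul b2 b3 (frobSq_nonneg _) (mul_nonneg b0 n1)
    refine abs_le_of_sq_le_sq' (a := ‖((R * C) * Rᵀ).trace‖) ?_ (by positivity) |>.2
    refine b1.trans (b4.trans ?_)
    have b5 : (frobSq F * (frobSq (F * C) + frobSq (F * W) / 2)) ^ 2
        - frobSq F * frobSq (F * C) * (frobSq F * frobSq F)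
        = frobSq F ^ 2 * (frobSq (F * W) / 2) ^ 2 := by
      linear_combination -(frobSq F ^ 2 * frobSq (F * C)) * hsum
    have b6 : 0 ≤ frobSq F ^ 2 * (frobSq (F * W) / 2) ^ 2 := by positivity
    linarith
  have hxr : R.trace.re = frobSq F := by rw [hx, Complex.ofReal_re]
  have hrr : (R * C).trace.re = frobSq (F * C) := by rw [hr, Complex.ofReal_re]
  refine ⟨?_, by rw [hxr, hrr]; linarith⟩
  have t4 := Complex.abs_re_le_norm ((R * C) * Rᵀ).trace
  have t5 := neg_le_of_abs_le (t4.trans t3)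
  rw [t1, t2, hx, hr, Complex.add_re, Complex.add_re, Complex.re_ofReal_mul, Complex.sub_re,
    Complex.sub_re, Complex.sub_re, Complex.re_ofReal_mul, Complex.re_ofReal_mul,
    Complex.ofReal_re, Complex.ofReal_re]
  have b0 := frobSq_nonneg F
  have c1 : 0 ≤ η * frobSq (F * C) := by positivity
  have c2 := mul_le_mul_of_nonneg_left t5 hη.le
  have c3 : η * frobSq F * frobSq (F * W) ≤ η * frobSq F * ∑ a, h a :=
    mul_le_mul_of_nonneg_left hr22 (by positivity)
  nlinarith

end

/-! ### Functions of polynomial growth -/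

section
variable {ι : Type*} [Fintype ι] [DecidableEq ι]

/-- Continuous functions of polynomial growth of degree at most `d`. -/
def PolyGrowth (d : ℕ) (f : (ι → ℝ) → ℂ) : Prop :=
  Continuous f ∧ ∃ c : ℝ, 0 ≤ c ∧ ∀ G, ‖f G‖ ≤ c * (1 + ‖G‖) ^ d

namespace PolyGrowth
variable {d d' : ℕ} {f f' : (ι → ℝ) → ℂ}

theorem mono (h : PolyGrowth d f) (hd : d ≤ d') : PolyGrowth d' f := by
  obtain ⟨h1, c, hc, h2⟩ := h
  refine ⟨h1, c, hc, fun G => (h2 G).trans ?_⟩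
  exact mul_le_mul_of_nonneg_left (pow_le_pow_right₀ (by linarith [norm_nonneg G]) hd) hc

theorem const (z : ℂ) : PolyGrowth d (fun _ : ι → ℝ => z) := by
  refine PolyGrowth.mono (d := 0) ?_ (Nat.zero_le _)
  exact ⟨continuous_const, ‖z‖, norm_nonneg _, fun G => by simp⟩

theorem eval (e : ι) : PolyGrowth 1 (fun G : ι → ℝ => (G e : ℂ)) := by
  refine ⟨by fun_prop, 1, zero_le_one, fun G => ?_⟩
  rw [Complex.norm_real]
  have := norm_le_pi_norm G e
  linarith

theorem add (h : PolyGrowth d f) (h' : PolyGrowth d f') :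
    PolyGrowth d (fun G => f G + f' G) := by
  obtain ⟨h1, c, hc, h2⟩ := h
  obtain ⟨h1', c', hc', h2'⟩ := h'
  refine ⟨h1.add h1', c + c', add_nonneg hc hc', fun G => (norm_add_le _ _).trans ?_⟩
  rw [add_mul]
  exact add_le_add (h2 G) (h2' G)

theorem mul (h : PolyGrowth d f) (h' : PolyGrowth d' f') :
    PolyGrowth (d + d') (fun G => f G * f' G) := by
  obtain ⟨h1, c, hc, h2⟩ := h
  obtain ⟨h1', c', hc', h2'⟩ := h'
  refine ⟨h1.mul h1', c * c', mul_nonneg hc hc', fun G => ?_⟩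
  rw [norm_mul, pow_add]
  refine (mul_le_mul (h2 G) (h2' G) (norm_nonneg _) (by positivity)).trans (le_of_eq ?_)
  ring

theorem neg (h : PolyGrowth d f) : PolyGrowth d (fun G => -f G) := by
  have := (const (ι := ι) (d := 0) (-1)).mul h
  simpa using this

theorem sum {β : Type*} (s : Finset β) {F : β → (ι → ℝ) → ℂ} (h : ∀ b ∈ s, PolyGrowth d (F b)) :
    PolyGrowth d (fun G => ∑ b ∈ s, F b G) := by
  classical
  induction s using Finset.induction_on with
  | empty => simpa using const (ι := ι) (d := d) 0
  | insert b s hb ih =>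
    simp only [Finset.sum_insert hb]
    exact (h b (Finset.mem_insert_self _ _)).add
      (ih fun b' hb' => h b' (Finset.mem_insert_of_mem hb'))

theorem integrable (h : PolyGrowth 2 f) : Integrable f (stdNormalPi ι) := by
  obtain ⟨h1, c, hc, h2⟩ := h
  refine integrable_stdNormalPi_of_le h1 (2 * c) fun G => (h2 G).trans ?_
  have h3 : ‖G‖ ^ 2 ≤ ∑ e, G e ^ 2 := by
    have h0 : 0 ≤ ∑ e, G e ^ 2 := Finset.sum_nonneg fun _ _ => sq_nonneg _
    have : ‖G‖ ≤ √(∑ e, G e ^ 2) := by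
      rw [pi_norm_le_iff_of_nonneg (Real.sqrt_nonneg _)]
      intro e
      rw [Real.norm_eq_abs]
      refine Real.abs_le_sqrt ?_
      exact Finset.single_le_sum (f := fun e => G e ^ 2) (fun _ _ => sq_nonneg _)
        (Finset.mem_univ e)
    calc ‖G‖ ^ 2 ≤ √(∑ e, G e ^ 2) ^ 2 := pow_le_pow_left₀ (norm_nonneg _) this 2
      _ = _ := Real.sq_sqrt h0
  have : (1 + ‖G‖) ^ 2 ≤ 2 * (1 + ∑ e, G e ^ 2) := by nlinarith [sq_nonneg (1 - ‖G‖)]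
  calc c * (1 + ‖G‖) ^ 2 ≤ c * (2 * (1 + ∑ e, G e ^ 2)) := mul_le_mul_of_nonneg_left this hc
    _ = _ := by ring

theorem trace {β : Type*} [Fintype β] {F : (ι → ℝ) → Matrix β β ℂ}
    (h : ∀ i j, PolyGrowth d (fun G => F G i j)) : PolyGrowth d (fun G => (F G).trace) :=
  sum Finset.univ fun i _ => h i i

theorem matrix_mul {β γ δ : Type*} [Fintype γ] {F : (ι → ℝ) → Matrix β γ ℂ}
    {F' : (ι → ℝ) → Matrix γ δ ℂ} (h : ∀ i j, PolyGrowth d (fun G => F G i j))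
    (h' : ∀ i j, PolyGrowth d' (fun G => F' G i j)) (i : β) (j : δ) :
    PolyGrowth (d + d') (fun G => (F G * F' G) i j) :=
  sum Finset.univ fun l _ => (h i l).mul (h' l j)

theorem const_matrix_mul {β γ δ : Type*} [Fintype γ] (A : Matrix β γ ℂ)
    {F : (ι → ℝ) → Matrix γ δ ℂ} (h : ∀ i j, PolyGrowth d (fun G => F G i j)) (i : β) (j : δ) :
    PolyGrowth d (fun G => (A * F G) i j) := by
  have := matrix_mul (d := 0) (F := fun _ => A) (fun i j => const (A i j)) h i j
  rwa [zero_add] at this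

theorem matrix_mul_const {β γ δ : Type*} [Fintype γ] (A : Matrix γ δ ℂ)
    {F : (ι → ℝ) → Matrix β γ ℂ} (h : ∀ i j, PolyGrowth d (fun G => F G i j)) (i : β) (j : δ) :
    PolyGrowth d (fun G => (F G * A) i j) :=
  matrix_mul (d' := 0) (F' := fun _ => A) h (fun i j => const (A i j)) i j

end PolyGrowth

end

/-! ### Stein's identity for the regularized inverse -/

section
open Matrix
open scoped ComplexOrder

variable {ι κ α : Type*} [Fintype ι] [Fintype κ] [Fintype α]
  [DecidableEq ι] [DecidableEq κ] [DecidableEq α]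

/-- A vector of real numbers indexed by pairs, regarded as a complex matrix. -/
noncomputable def gaussMat (G : ι × κ → ℝ) : Matrix ι κ ℂ := Matrix.of fun i a => (G (i, a) : ℂ)

theorem conjTranspose_gaussMat (G : ι × κ → ℝ) : (gaussMat G)ᴴ = (gaussMat G)ᵀ := by
  ext i j
  simp [gaussMat]

theorem gaussMat_update (G : ι × κ → ℝ) (e : ι × κ) (t : ℝ) :
    gaussMat (Function.update G e t) = gaussMat G + (t - G e) • single e.1 e.2 (1 : ℂ) := by
  ext i a
  by_cases h : (i, a) = e
  · subst h
    simp [gaussMat]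
  · have h2 : ¬ (e.1 = i ∧ e.2 = a) := by
      rintro ⟨rfl, rfl⟩; exact h rfl
    simp [gaussMat, Function.update_of_ne h, h2]

variable {W : Matrix ι α ℂ} {h : α → ℝ} {η : ℝ}

attribute [local instance] Matrix.linftyOpNormedRing Matrix.linftyOpNormedAlgebra in
-- Changing one entry of `G` perturbs the regularized Gram matrix quadratically; the linear
-- coefficient `E` gives the derivative `-R E R` of the inverse.
theorem hasDerivAt_regInv_update (hh : ∀ a, 0 < h a) (hη : 0 < η) (G : ι × κ → ℝ) (e : ι × κ)
    (j l : ι) :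
    HasDerivAt (fun t => regInv (gaussMat (Function.update G e t)) W h η j l)
      (-(regInv (gaussMat G) W h η * (single e.1 e.2 (1 : ℂ) * (gaussMat G)ᵀ
        + gaussMat G * single e.2 e.1 (1 : ℂ)) * regInv (gaussMat G) W h η) j l) (G e) := by
  set M := regGram (gaussMat G) W h η with hM
  set E : Matrix ι ι ℂ := single e.1 e.2 (1 : ℂ) * (gaussMat G)ᵀ
        + gaussMat G * single e.2 e.1 (1 : ℂ) with hE
  have h1 : ∀ t, regGram (gaussMat (Function.update G e t)) W h η
      = M + ((t - G e) • E + (t - G e) ^ 2 • (single e.1 e.2 (1 : ℂ) * single e.2 e.1 (1 : ℂ))) := by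
    intro t
    rw [hM, hE, gaussMat_update]
    unfold regGram
    rw [transpose_add, transpose_smul, transpose_single]
    simp only [Matrix.mul_add, Matrix.add_mul, Matrix.smul_mul, Matrix.mul_smul, smul_add,
      smul_smul, sq]
    abel
  have h2 : HasDerivAt (fun t => regGram (gaussMat (Function.update G e t)) W h η) E (G e) := by
    simp_rw [h1]
    have d1 : HasDerivAt (fun t : ℝ => t - G e) 1 (G e) := (hasDerivAt_id _).sub_const _
    have := ((d1.smul_const E).add ((d1.pow 2).smul_const
      ((single e.1 e.2 (1 : ℂ) * single e.2 e.1 (1 : ℂ)) : Matrix ι ι ℂ))).const_add M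
    refine this.congr_deriv ?_
    simp
  have hu : IsUnit M := (posDef_regGram (conjTranspose_gaussMat G) hh hη).isUnit
  obtain ⟨u, hu⟩ := hu
  have h3 := hasFDerivAt_ringInverse (𝕜 := ℝ) u
  have h0 : regGram (gaussMat (Function.update G e (G e))) W h η = M := by simp [hM]
  rw [hu, ← h0] at h3
  have h4 := h3.comp_hasDerivAt (G e) h2
  let L : Matrix ι ι ℂ →L[ℝ] ℂ :=
    LinearMap.toContinuousLinearMap (Matrix.entryLinearMap ℝ ℂ j l)
  have h5 := L.hasFDerivAt.comp_hasDerivAt (G e) h4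
  have e1 : (↑u⁻¹ : Matrix ι ι ℂ) = regInv (gaussMat G) W h η := by
    rw [← Ring.inverse_unit, hu, ← nonsing_inv_eq_ringInverse]; rfl
  refine (h5.congr_deriv ?_).congr_of_eventuallyEq (Filter.Eventually.of_forall fun t => ?_)
  · simp only [e1, L]
    simp
    rfl
  · simp only [Function.comp, L, regInv, nonsing_inv_eq_ringInverse]
    rfl

theorem polyGrowth_gaussMat (i : ι) (a : κ) :
    PolyGrowth 1 (fun G : ι × κ → ℝ => gaussMat G i a) := PolyGrowth.eval (i, a)

theorem polyGrowth_regInv (hh : ∀ a, 0 < h a) (hη : 0 < η) (i j : ι) :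
    PolyGrowth 0 (fun G : ι × κ → ℝ => regInv (gaussMat G) W h η i j) := by
  refine ⟨?_, √(Fintype.card ι / η / η), Real.sqrt_nonneg _, fun G => ?_⟩
  · have hg : Continuous (fun G : ι × κ → ℝ => gaussMat G) :=
      continuous_pi fun i => continuous_pi fun a => (polyGrowth_gaussMat i a).1
    have hM : Continuous (fun G : ι × κ → ℝ => regGram (gaussMat G) W h η) := by
      unfold regGram
      exact ((hg.matrix_mul hg.matrix_transpose).add continuous_const).add continuous_const
    have hR : Continuous (fun G : ι × κ → ℝ => regInv (gaussMat G) W h η) := by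
      unfold regInv
      simp only [inv_def, Ring.inverse_eq_inv']
      refine Continuous.smul (hM.matrix_det.inv₀ fun G => ?_) hM.matrix_adjugate
      exact (posDef_regGram (conjTranspose_gaussMat G) hh hη).det_pos.ne'
    exact (continuous_apply j).comp ((continuous_apply i).comp hR)
  · rw [pow_zero, mul_one]
    exact Real.le_sqrt_of_sq_le (norm_regInv_sq_le (conjTranspose_gaussMat G) hh hη i j)

/-- The trace identity obtained by summing Stein's identity over all entries of the matrix. -/
theorem integral_trace_stein (hh : ∀ a, 0 < h a) (hη : 0 < η) (C : Matrix ι ι ℂ) :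
    ∫ G : ι × κ → ℝ, ((gaussMat G)ᵀ * (regInv (gaussMat G) W h η * C * gaussMat G)).trace
        ∂(stdNormalPi (ι × κ))
      = ∫ G : ι × κ → ℝ, ((Fintype.card κ : ℂ) * (regInv (gaussMat G) W h η * C).trace
          - (regInv (gaussMat G) W h η).trace
            * ((gaussMat G)ᵀ * (regInv (gaussMat G) W h η * C * gaussMat G)).trace
          - ((regInv (gaussMat G) W h η * gaussMat G)ᵀ
              * (regInv (gaussMat G) W h η * C * gaussMat G)).trace) ∂(stdNormalPi (ι × κ)) := by
  have pR := polyGrowth_regInv (W := W) (κ := κ) hh hη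
  have pG := polyGrowth_gaussMat (ι := ι) (κ := κ)
  set R : (ι × κ → ℝ) → Matrix ι ι ℂ := fun G => regInv (gaussMat G) W h η with hR
  have pRG : ∀ i a, PolyGrowth 1 (fun G : ι × κ → ℝ => (R G * gaussMat G) i a) := fun i a => by
    simpa using PolyGrowth.matrix_mul pR pG i a
  have pRC := PolyGrowth.matrix_mul_const C pR
  have pRCG : ∀ i a, PolyGrowth 1 (fun G : ι × κ → ℝ => (R G * C * gaussMat G) i a) :=
    fun i a => by simpa using PolyGrowth.matrix_mul pRC pG i a
  let D : ι × κ → (ι × κ → ℝ) → ℂ := fun e G =>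
    -(R G e.1 e.1 * ((gaussMat G)ᵀ * (R G * C * gaussMat G)) e.2 e.2
      + (R G * gaussMat G) e.1 e.2 * (R G * C * gaussMat G) e.1 e.2) + (R G * C) e.1 e.1
  have pD : ∀ e, PolyGrowth 2 (D e) := fun e => by
    refine (PolyGrowth.neg (PolyGrowth.add ?_ ((pRG _ _).mul (pRCG _ _)))).add
      ((pRC _ _).mono (Nat.zero_le _))
    have := (pR e.1 e.1).mul
      (PolyGrowth.matrix_mul (F := fun G => (gaussMat G)ᵀ) (fun a i => pG i a) pRCG e.2 e.2)
    simpa using this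
  have hder : ∀ e G, HasDerivAt
      (fun t => (R (Function.update G e t) * C * gaussMat (Function.update G e t)) e.1 e.2)
      (D e G) (G e) := by
    intro e G
    have h1 : ∀ j l, HasDerivAt (fun t => R (Function.update G e t) j l)
      (-(R G * (single e.1 e.2 (1 : ℂ) * (gaussMat G)ᵀ
        + gaussMat G * single e.2 e.1 (1 : ℂ)) * R G) j l) (G e) :=
      fun j l => hasDerivAt_regInv_update hh hη G e j l
    have h2 : ∀ j, HasDerivAt (fun t => (R (Function.update G e t) * C) e.1 j)
      (∑ l, -(R G * (single e.1 e.2 (1 : ℂ) * (gaussMat G)ᵀ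
        + gaussMat G * single e.2 e.1 (1 : ℂ)) * R G) e.1 l * C l j) (G e) := fun j => by
      simp only [mul_apply (N := C)]
      exact HasDerivAt.fun_sum fun l _ => (h1 e.1 l).mul_const _
    have h3 : ∀ j, HasDerivAt (fun t => gaussMat (Function.update G e t) j e.2)
      (single e.1 e.2 (1 : ℂ) j e.2) (G e) := fun j => by
      simp only [gaussMat_update, Matrix.add_apply, Matrix.smul_apply]
      have d1 : HasDerivAt (fun t : ℝ => t - G e) 1 (G e) := (hasDerivAt_id _).sub_const _
      simpa using (d1.smul_const (single e.1 e.2 (1 : ℂ) j e.2)).const_add (gaussMat G j e.2)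
    have h4 := HasDerivAt.fun_sum (u := Finset.univ) fun j _ => (h2 j).mul (h3 j)
    have h5 : (fun t => ∑ j, (R (Function.update G e t) * C) e.1 j
        * gaussMat (Function.update G e t) j e.2)
        = fun t => (R (Function.update G e t) * C * gaussMat (Function.update G e t)) e.1 e.2 := by
      ext t; rw [mul_apply]
    rw [← h5]
    refine h4.congr_deriv ?_
    rw [Function.update_eq_self, Finset.sum_add_distrib]
    have e1 : ∑ j, (∑ l, -(R G * (single e.1 e.2 (1 : ℂ) * (gaussMat G)ᵀ
        + gaussMat G * single e.2 e.1 (1 : ℂ)) * R G) e.1 l * C l j) * gaussMat G j e.2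
        = -(R G * (single e.1 e.2 (1 : ℂ) * (gaussMat G)ᵀ
        + gaussMat G * single e.2 e.1 (1 : ℂ)) * R G * C * gaussMat G) e.1 e.2 := by
      simp only [mul_apply (N := gaussMat G), mul_apply (N := C), neg_mul,
        Finset.sum_neg_distrib]
    have e2 : R G * (single e.1 e.2 (1 : ℂ) * (gaussMat G)ᵀ
        + gaussMat G * single e.2 e.1 (1 : ℂ)) * R G * C * gaussMat G
        = R G * single e.1 e.2 (1 : ℂ) * ((gaussMat G)ᵀ * (R G * C * gaussMat G))
        + R G * gaussMat G * single e.2 e.1 (1 : ℂ) * (R G * C * gaussMat G) := by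
      simp only [Matrix.mul_add, Matrix.add_mul, Matrix.mul_assoc]
    have e3 : ∀ (X : Matrix ι ι ℂ) (Y : Matrix κ κ ℂ),
        (X * single e.1 e.2 (1 : ℂ) * Y) e.1 e.2 = X e.1 e.1 * Y e.2 e.2 := by
      intro X Y
      rw [mul_apply, Finset.sum_eq_single e.2]
      · simp
      · intro b _ hb
        simp [mul_single_apply_of_ne _ _ _ _ _ hb]
      · simp
    have e4 : ∀ (X : Matrix ι κ ℂ) (Y : Matrix ι κ ℂ),
        (X * single e.2 e.1 (1 : ℂ) * Y) e.1 e.2 = X e.1 e.2 * Y e.1 e.2 := by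
      intro X Y
      rw [mul_apply, Finset.sum_eq_single e.1]
      · simp
      · intro b _ hb
        simp [mul_single_apply_of_ne _ _ _ _ _ hb]
      · simp
    -- The two halves of the derivative of `g gᵀ` behave differently: summed over `e`, one gives a
    -- product of two traces, the other a single transposed trace. Differentiating the factor `g`
    -- gives `(R C) e.1 e.1`.
    rw [e1, e2, Matrix.add_apply, e3, e4]
    congr 1
    rw [Finset.sum_eq_single e.1]
    · simp
    · intro b _ hb
      simp [hb.symm]
    · simp
  have stein : ∀ e, ∫ G : ι × κ → ℝ, (G e : ℂ) * (R G * C * gaussMat G) e.1 e.2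
      ∂(stdNormalPi (ι × κ)) = ∫ G, D e G ∂(stdNormalPi (ι × κ)) := fun e =>
    integral_stdNormalPi_mul_eq_integral_deriv e (hder e) ((pRCG _ _).mono one_le_two).integrable
      ((PolyGrowth.eval e).mul (pRCG _ _)).integrable (pD e).integrable
  have hs := Finset.sum_congr (s₁ := Finset.univ) rfl fun e _ => stein e
  rw [← integral_finsetSum _ fun e _ => ((PolyGrowth.eval e).mul (pRCG _ _)).integrable,
    ← integral_finsetSum _ fun e _ => (pD e).integrable] at hs
  refine Eq.trans (integral_congr_ae (Filter.Eventually.of_forall fun G => ?_))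
    (hs.trans (integral_congr_ae (Filter.Eventually.of_forall fun G => ?_)))
  · simp only [trace, diag, mul_apply (M := (gaussMat G)ᵀ), transpose_apply]
    rw [Fintype.sum_prod_type_right]
    rfl
  · simp only [D]
    rw [Fintype.sum_prod_type, transpose_mul]
    simp only [Finset.sum_add_distrib, Finset.sum_neg_distrib]
    have f1 : ∑ i, ∑ a, R G i i * ((gaussMat G)ᵀ * (R G * C * gaussMat G)) a a
        = (R G).trace * ((gaussMat G)ᵀ * (R G * C * gaussMat G)).trace := by
      simp only [trace, diag, Finset.sum_mul_sum]
    have f2 : ∑ i, ∑ a, (R G * gaussMat G) i a * (R G * C * gaussMat G) i a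
        = ((gaussMat G)ᵀ * (R G)ᵀ * (R G * C * gaussMat G)).trace := by
      rw [← transpose_mul, Finset.sum_comm]
      simp only [trace, diag, mul_apply (M := (R G * gaussMat G)ᵀ), transpose_apply]
    have f3 : ∑ i, ∑ _a : κ, (R G * C) i i = (Fintype.card κ : ℂ) * (R G * C).trace := by
      simp only [Finset.sum_const, Finset.card_univ, nsmul_eq_mul, trace, diag, Finset.mul_sum]
    rw [f1, f2, f3]
    ring

theorem integrable_trace_regInv_mul (hh : ∀ a, 0 < h a) (hη : 0 < η) (C : Matrix ι ι ℂ) :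
    Integrable (fun G : ι × κ → ℝ => (regInv (gaussMat G) W h η * C).trace)
      (stdNormalPi (ι × κ)) :=
  ((PolyGrowth.trace (PolyGrowth.matrix_mul_const C (polyGrowth_regInv hh hη))).mono
    (Nat.zero_le _)).integrable

theorem integrable_trace_regInv_re (hh : ∀ a, 0 < h a) (hη : 0 < η) :
    Integrable (fun G : ι × κ → ℝ => (regInv (gaussMat G) W h η).trace.re)
      (stdNormalPi (ι × κ)) := by
  simpa using (integrable_trace_regInv_mul (W := W) (κ := κ) hh hη 1).re

/-- By `h` the sum `T₁ + T₂ + T₃` has mean `k E Y`, so the pointwise bound can be integrated for the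
sum even though no single term is controlled. -/
theorem integral_re_le_of_stein {Ω : Type*} [MeasurableSpace Ω] {P : Measure Ω}
    [IsProbabilityMeasure P] {T₁ T₂ T₃ Y : Ω → ℂ} {x : Ω → ℝ} {k a b : ℝ}
    (h₁ : Integrable T₁ P) (h₂ : Integrable T₂ P) (h₃ : Integrable T₃ P) (hY : Integrable Y P)
    (hx : Integrable x P)
    (h : ∫ ω, T₁ ω ∂P = ∫ ω, ((k : ℂ) * Y ω - T₂ ω - T₃ ω) ∂P)
    (hle : ∀ ω, (T₁ ω + T₂ ω + T₃ ω).re ≤ a * (1 + x ω) + (Y ω).re + b * x ω) :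
    k * ∫ ω, (Y ω).re ∂P ≤ a * (1 + ∫ ω, x ω ∂P) + ∫ ω, (Y ω).re ∂P + b * ∫ ω, x ω ∂P := by
  have hk : Integrable (fun ω => (k : ℂ) * Y ω) P := hY.const_mul _
  have hk2 : Integrable (fun ω => (k : ℂ) * Y ω - T₂ ω) P := hk.sub h₂
  rw [integral_sub hk2 h₃, integral_sub hk h₂, integral_const_mul] at h
  have h12 : Integrable (fun ω => T₁ ω + T₂ ω) P := h₁.add h₂
  have h123 : Integrable (fun ω => T₁ ω + T₂ ω + T₃ ω) P := h12.add h₃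
  have e0 : ∫ ω, (T₁ ω + T₂ ω + T₃ ω) ∂P = (k : ℂ) * ∫ ω, Y ω ∂P := by
    rw [integral_add h12 h₃, integral_add h₁ h₂, h]
    ring
  have e1 : ∫ ω, (T₁ ω + T₂ ω + T₃ ω).re ∂P = (∫ ω, (T₁ ω + T₂ ω + T₃ ω) ∂P).re :=
    integral_re h123
  have e2 : ∫ ω, (Y ω).re ∂P = (∫ ω, Y ω ∂P).re := integral_re hY
  rw [e0, Complex.re_ofReal_mul, ← e2] at e1
  rw [← e1]
  have hYr : Integrable (fun ω => (Y ω).re) P := hY.re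
  have hx1 : Integrable (fun ω => 1 + x ω) P := (integrable_const 1).add hx
  have hax : Integrable (fun ω => a * (1 + x ω)) P := hx1.const_mul a
  have haxy : Integrable (fun ω => a * (1 + x ω) + (Y ω).re) P := hax.add hYr
  have hbx : Integrable (fun ω => b * x ω) P := hx.const_mul b
  have hr : Integrable (fun ω => (T₁ ω + T₂ ω + T₃ ω).re) P := h123.re
  refine (integral_mono hr (haxy.add hbx) hle).trans (le_of_eq ?_)
  simp only [Pi.add_apply]
  rw [integral_add haxy hbx, integral_add hax hYr, integral_const_mul, integral_const_mul,
    integral_add (integrable_const 1) hx]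
  simp

/-- A bound for the expected trace of the regularized inverse of a Gaussian Gram matrix. -/
theorem integral_trace_regInv_le (hh : ∀ a, 0 < h a) (hη : 0 < η) {d : α → ℂ}
    (hW : Wᴴ * W = 1) (hd : Wᵀ * W = diagonal d) {s : ℝ} (hs : (1 - W * Wᴴ).trace.re ≤ s)
    (hκ : 1 ≤ Fintype.card κ) :
    ((Fintype.card κ : ℝ) - 1 - s - η * (∑ a, h a) / 2) *
        ∫ G : ι × κ → ℝ, (regInv (gaussMat G) W h η).trace.re ∂(stdNormalPi (ι × κ))
      ≤ s + ((Fintype.card κ : ℝ) - 1) * ∑ a, h a := by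
  have pR := polyGrowth_regInv (W := W) (κ := κ) hh hη
  have pG := polyGrowth_gaussMat (ι := ι) (κ := κ)
  have hst := integral_trace_stein (W := W) (κ := κ) hh hη (1 - W * Wᴴ)
  have iR := integrable_trace_regInv_re (W := W) (κ := κ) hh hη
  have iRC := integrable_trace_regInv_mul (W := W) (κ := κ) hh hη (1 - W * Wᴴ)
  have tb := fun G : ι × κ → ℝ => trace_bounds (conjTranspose_gaussMat G) hh hη hW hd
  generalize 1 - W * Wᴴ = C at *
  have pRG : ∀ i a, PolyGrowth 1
      (fun G : ι × κ → ℝ => (regInv (gaussMat G) W h η * gaussMat G) i a) := fun i a => by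
    simpa using PolyGrowth.matrix_mul pR pG i a
  have pRCG : ∀ i a, PolyGrowth 1
      (fun G : ι × κ → ℝ => (regInv (gaussMat G) W h η * C * gaussMat G) i a) :=
    fun i a => by simpa using PolyGrowth.matrix_mul (PolyGrowth.matrix_mul_const C pR) pG i a
  have p1 : PolyGrowth 2 (fun G : ι × κ → ℝ =>
      ((gaussMat G)ᵀ * (regInv (gaussMat G) W h η * C * gaussMat G)).trace) :=
    PolyGrowth.trace (PolyGrowth.matrix_mul (F := fun G => (gaussMat G)ᵀ) (fun a i => pG i a) pRCG)
  have p2 : PolyGrowth 2 (fun G : ι × κ → ℝ => (regInv (gaussMat G) W h η).trace *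
      ((gaussMat G)ᵀ * (regInv (gaussMat G) W h η * C * gaussMat G)).trace) := by
    simpa using (PolyGrowth.trace pR).mul p1
  have p3 : PolyGrowth 2 (fun G : ι × κ → ℝ => ((regInv (gaussMat G) W h η * gaussMat G)ᵀ
      * (regInv (gaussMat G) W h η * C * gaussMat G)).trace) :=
    PolyGrowth.trace (PolyGrowth.matrix_mul
      (F := fun G => (regInv (gaussMat G) W h η * gaussMat G)ᵀ) (fun a i => pRG i a) pRCG)
  have i1 := p1.integrable
  have i2 := p2.integrable
  have i3 := p3.integrable
  have h3 := integral_re_le_of_stein i1 i2 i3 iRC iR hst (fun G => (tb G).1)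
  have iRCr : Integrable (fun G : ι × κ → ℝ => (regInv (gaussMat G) W h η * C).trace.re)
      (stdNormalPi (ι × κ)) := iRC.re
  have h4 := integral_mono_ae (iR.sub (integrable_const (∑ a, h a))) iRCr
    (Filter.Eventually.of_forall fun G => (tb G).2)
  simp only [Pi.sub_apply] at h4
  rw [integral_sub iR (integrable_const _)] at h4
  simp only [integral_const, probReal_univ, one_smul] at h4
  set x := ∫ G : ι × κ → ℝ, (regInv (gaussMat G) W h η).trace.re ∂(stdNormalPi (ι × κ)) with hx
  have hx0 : 0 ≤ x := integral_nonneg fun G =>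
    re_trace_regInv_nonneg (conjTranspose_gaussMat G) hh hη
  set y := ∫ G : ι × κ → ℝ, (regInv (gaussMat G) W h η * C).trace.re ∂(stdNormalPi (ι × κ))
  have hκ' : (1 : ℝ) ≤ Fintype.card κ := by exact_mod_cast hκ
  -- In `h3` one copy of `y` is absorbed on the left, leaving `(k - 1) y`; then `y ≥ x - ∑ h` turns
  -- it into an inequality for `x` alone.
  have h5 : ((Fintype.card κ : ℝ) - 1) * (x - ∑ a, h a) ≤ ((Fintype.card κ : ℝ) - 1) * y :=
    mul_le_mul_of_nonneg_left h4 (by linarith)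
  have h6 : C.trace.re * (1 + x) ≤ s * (1 + x) := mul_le_mul_of_nonneg_right hs (by linarith)
  nlinarith

end

/-! ### Reflections adapted to `W` and Takagi's factorization -/

section
open Matrix

variable {ι κ α β : Type*} [Fintype ι] [Fintype κ] [Fintype α] [Fintype β]
  [DecidableEq ι] [DecidableEq κ] [DecidableEq α] [DecidableEq β]

/-- The real orthogonal reflection in the real span of the real and imaginary part of a column. -/
theorem exists_orthogonal_fix_column {W : Matrix ι α ℂ} {d : α → ℂ}
    (hW : Wᴴ * W = 1) (hd : Wᵀ * W = diagonal d) (a : α) :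
    ∃ O : Matrix ι ι ℝ, Oᵀ * O = 1 ∧
      O.map (fun x : ℝ => (x : ℂ)) * W = W * diagonal (fun b => if b = a then (1 : ℂ) else -1) := by
  let x : α → EuclideanSpace ℝ ι := fun b => WithLp.toLp 2 fun i => (W i b).re
  let y : α → EuclideanSpace ℝ ι := fun b => WithLp.toLp 2 fun i => (W i b).im
  let K : Submodule ℝ (EuclideanSpace ℝ ι) := Submodule.span ℝ {x a, y a}
  let O : Matrix ι ι ℝ := Matrix.toEuclideanLin.symm K.reflection.toLinearEquiv.toLinearMap
  have hO : ∀ v : EuclideanSpace ℝ ι, O *ᵥ v.ofLp = (K.reflection v).ofLp := by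
    intro v
    have : Matrix.toEuclideanLin O = K.reflection.toLinearEquiv.toLinearMap :=
      LinearEquiv.apply_symm_apply _ _
    have h2 := congrArg (fun f => WithLp.ofLp (f v)) this
    simpa [Matrix.toLpLin_apply] using h2
  have hx : K.reflection (x a) = x a :=
    Submodule.reflection_mem_subspace_eq_self (Submodule.subset_span (by simp))
  have hy : K.reflection (y a) = y a :=
    Submodule.reflection_mem_subspace_eq_self (Submodule.subset_span (by simp))
  -- Both the Hermitian and the bilinear product of columns `a` and `b` vanish. Their real and
  -- imaginary parts say that `x b` and `y b` are each orthogonal to `x a` and `y a`.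
  have horth : ∀ b, b ≠ a → x b ∈ Kᗮ ∧ y b ∈ Kᗮ := by
    intro b hb
    have h1 : ∑ i, star (W i b) * W i a = 0 := by
      have := congrFun (congrFun hW b) a
      rwa [one_apply_ne hb, mul_apply] at this
    have h2 : ∑ i, W i b * W i a = 0 := by
      have := congrFun (congrFun hd b) a
      rwa [diagonal_apply_ne _ hb, mul_apply] at this
    have h1r := congrArg Complex.re h1
    have h1i := congrArg Complex.im h1
    have h2r := congrArg Complex.re h2
    have h2i := congrArg Complex.im h2
    simp only [Complex.re_sum, Complex.im_sum, Complex.mul_re, Complex.mul_im, Complex.star_def,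
      Complex.conj_re, Complex.conj_im, Complex.zero_re, Complex.zero_im, Finset.sum_add_distrib,
      Finset.sum_sub_distrib, neg_mul, Finset.sum_neg_distrib] at h1r h1i h2r h2i
    have hin : ∀ u v : EuclideanSpace ℝ ι, inner ℝ u v = ∑ i, v i * u i := fun u v => by
      simp [PiLp.inner_apply]
    constructor
    · rw [Submodule.mem_orthogonal']
      intro u hu
      refine Submodule.span_induction (p := fun u _ => inner ℝ (x b) u = 0) ?_ (by simp)
        (fun u v _ _ h1 h2 => by rw [inner_add_right, h1, h2, add_zero])
        (fun c u _ h1 => by rw [inner_smul_right, h1, mul_zero]) hu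
      rintro u (rfl | rfl)
      · rw [hin]; simp only [x, mul_comm (W _ a).re]; linarith
      · rw [hin]; simp only [x, y, mul_comm (W _ a).im]; linarith
    · rw [Submodule.mem_orthogonal']
      intro u hu
      refine Submodule.span_induction (p := fun u _ => inner ℝ (y b) u = 0) ?_ (by simp)
        (fun u v _ _ h1 h2 => by rw [inner_add_right, h1, h2, add_zero])
        (fun c u _ h1 => by rw [inner_smul_right, h1, mul_zero]) hu
      rintro u (rfl | rfl)
      · rw [hin]; simp only [x, y, mul_comm (W _ a).re]; linarith
      · rw [hin]; simp only [y, mul_comm (W _ a).im]; linarith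
  refine ⟨O, ?_, ?_⟩
  · ext i j
    have h1 : ∀ i, (fun l => O l i) = (K.reflection (EuclideanSpace.single i 1)).ofLp := by
      intro i
      rw [← hO]
      ext l
      simp
    have h2 : (Oᵀ * O) i j = inner ℝ (K.reflection (EuclideanSpace.single i 1))
        (K.reflection (EuclideanSpace.single j (1 : ℝ))) := by
      rw [mul_apply, PiLp.inner_apply]
      refine Finset.sum_congr rfl fun l _ => ?_
      rw [← congrFun (h1 i) l, ← congrFun (h1 j) l]
      simp [mul_comm]
    rw [h2, LinearIsometryEquiv.inner_map_map]
    rw [EuclideanSpace.inner_single_left]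
    simp [one_apply]
  · ext i b
    rw [mul_diagonal, mul_apply]
    have key : ∀ c : ℝ, K.reflection (x b) = c • x b → K.reflection (y b) = c • y b →
        ∑ j, (O.map (fun x : ℝ => (x : ℂ))) i j * W j b = W i b * c := by
      intro c hxb hyb
      have e1 := congrFun (hO (x b)) i
      have e2 := congrFun (hO (y b)) i
      rw [hxb] at e1
      rw [hyb] at e2
      simp only [mulVec, dotProduct, x, y, PiLp.smul_apply, smul_eq_mul] at e1 e2
      apply Complex.ext
      · simp only [Complex.re_sum, map_apply, Complex.mul_re,
          Complex.ofReal_re, Complex.ofReal_im, mul_zero, zero_mul, sub_zero]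
        rw [e1, mul_comm]
      · simp only [Complex.im_sum, map_apply, Complex.mul_im,
          Complex.ofReal_re, Complex.ofReal_im, mul_zero, zero_mul, zero_add, add_zero]
        rw [e2, mul_comm]
    by_cases hb : b = a
    · subst hb
      simpa using key 1 (by simpa using hx) (by simpa using hy)
    · have := horth b hb
      simpa [hb] using key (-1)
        (by simpa using Submodule.reflection_mem_subspace_orthogonalComplement_eq_neg this.1)
        (by simpa using Submodule.reflection_mem_subspace_orthogonalComplement_eq_neg this.2)

/-- Take `v` maximizing the real part of the symmetric bilinear form `b v v` on the unit sphere of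
`V`. The first variation in a direction `w` orthogonal to `v` makes `b v w` have zero real part, and
the direction `I • w` handles the imaginary part. -/
theorem exists_unit_forall_orthogonal (Z : Matrix α α ℂ) (hZ : Zᵀ = Z)
    (V : Submodule ℂ (EuclideanSpace ℂ α)) (hV : V ≠ ⊥) :
    ∃ v ∈ V, ‖v‖ = 1 ∧ ∀ w ∈ V, inner ℂ v w = 0 → v.ofLp ⬝ᵥ (Z *ᵥ w.ofLp) = 0 := by
  let b : EuclideanSpace ℂ α → EuclideanSpace ℂ α → ℂ := fun u w => u.ofLp ⬝ᵥ (Z *ᵥ w.ofLp)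
  have hsymm : ∀ u w, b u w = b w u := by
    intro u w
    simp only [b]
    rw [dotProduct_mulVec, ← mulVec_transpose, hZ, dotProduct_comm]
  have hbadd : ∀ u w w', b u (w + w') = b u w + b u w' := by
    intro u w w'
    simp [b, mulVec_add, dotProduct_add]
  have hbsmul : ∀ (c : ℂ) u w, b u (c • w) = c * b u w := by
    intro c u w
    simp [b, mulVec_smul, dotProduct_smul]
  have hcont : Continuous fun u => (b u u).re := by
    refine Complex.continuous_re.comp ?_
    simp only [b, dotProduct, mulVec]
    fun_prop
  obtain ⟨v0, hv0, hv0n⟩ := Submodule.exists_mem_ne_zero_of_ne_bot hV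
  have hcomp : IsCompact ((V : Set (EuclideanSpace ℂ α)) ∩ Metric.sphere 0 1) :=
    (isCompact_sphere 0 1).inter_left V.closed_of_finiteDimensional
  obtain ⟨v, ⟨hvV, hv1⟩, hmax⟩ := hcomp.exists_isMaxOn
    ⟨((‖v0‖⁻¹ : ℝ) : ℂ) • v0, V.smul_mem _ hv0, by
      simp [norm_smul, inv_mul_cancel₀ (norm_ne_zero_iff.2 hv0n)]⟩ hcont.continuousOn
  rw [mem_sphere_zero_iff_norm] at hv1
  have hle : ∀ u ∈ V, (b u u).re ≤ (b v v).re * ‖u‖ ^ 2 := by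
    intro u hu
    by_cases h0 : u = 0
    · subst h0; simp [b]
    have hn : ‖u‖ ≠ 0 := norm_ne_zero_iff.2 h0
    have h1 := hmax (a := ((‖u‖⁻¹ : ℝ) : ℂ) • u)
      ⟨V.smul_mem _ hu, by simp [norm_smul, inv_mul_cancel₀ hn]⟩
    simp only [Set.mem_ofPred_eq] at h1
    rw [hbsmul, hsymm, hbsmul, Complex.re_ofReal_mul, Complex.re_ofReal_mul] at h1
    have h2 : 0 < ‖u‖ := norm_pos_iff.2 h0
    calc (b u u).re = (‖u‖⁻¹ * (‖u‖⁻¹ * (b u u).re)) * ‖u‖ ^ 2 := by field_simp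
      _ ≤ _ := mul_le_mul_of_nonneg_right h1 (sq_nonneg _)
  have hre : ∀ w ∈ V, inner ℂ v w = 0 → (b v w).re = 0 := by
    intro w hw horth
    have h1 : ∀ t : ℝ, 2 * t * (b v w).re ≤ t ^ 2 * ((b v v).re * ‖w‖ ^ 2 - (b w w).re) := by
      intro t
      have h2 := hle (v + (t : ℂ) • w) (V.add_mem hvV (V.smul_mem _ hw))
      have h3 : ‖v + (t : ℂ) • w‖ ^ 2 = 1 + t ^ 2 * ‖w‖ ^ 2 := by
        have := norm_add_sq (𝕜 := ℂ) v ((t : ℂ) • w)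
        rw [this, inner_smul_right, horth, norm_smul, hv1]
        simp [mul_pow]
      have h4 : b (v + (t : ℂ) • w) (v + (t : ℂ) • w)
          = b v v + (t : ℂ) * b v w + ((t : ℂ) * b v w + (t : ℂ) * ((t : ℂ) * b w w)) := by
        rw [hbadd, hsymm _ v, hbadd, hbsmul, hbsmul,
          hsymm (v + (t : ℂ) • w) w, hbadd, hbsmul, hsymm w v]
        ring
      rw [h3, h4] at h2
      simp only [Complex.add_re, Complex.re_ofReal_mul] at h2
      nlinarith
    set p := (b v w).re
    set c := (b v v).re * ‖w‖ ^ 2 - (b w w).re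
    -- This `t` turns `h1` into `2 p² / (|c| + 1) ≤ p² / (|c| + 1)`, forcing `p = 0`.
    have hpos := h1 (p / (|c| + 1))
    have hc : 0 < |c| + 1 := by positivity
    have h5 : (p / (|c| + 1)) ^ 2 * c ≤ (p / (|c| + 1)) ^ 2 * (|c| + 1) :=
      mul_le_mul_of_nonneg_left (by linarith [le_abs_self c]) (sq_nonneg _)
    have h6 : (p / (|c| + 1)) ^ 2 * (|c| + 1) = p ^ 2 / (|c| + 1) := by field_simp
    have h7 : 2 * (p / (|c| + 1)) * p = 2 * (p ^ 2 / (|c| + 1)) := by ring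
    have h8 : p ^ 2 / (|c| + 1) ≤ 0 := by linarith
    have h9 : p ^ 2 ≤ 0 := by
      by_contra hlt
      push Not at hlt
      exact absurd h8 (not_le.2 (div_pos hlt hc))
    exact (pow_eq_zero_iff two_ne_zero).1 (le_antisymm h9 (sq_nonneg p))
  refine ⟨v, hvV, hv1, fun w hw horth => ?_⟩
  change b v w = 0
  apply Complex.ext (hre w hw horth)
  have h := hre (Complex.I • w) (V.smul_mem _ hw) (by rw [inner_smul_right, horth, mul_zero])
  rw [hbsmul] at h
  simpa using h

/-- Induction on the dimension: split off the extremal vector `v` and continue in the Hermitian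
complement of `v` in `V`, on which the bilinear form against `v` already vanishes. -/
theorem exists_orthonormal_diagonalizing (Z : Matrix α α ℂ) (hZ : Zᵀ = Z) (n : ℕ) :
    ∀ V : Submodule ℂ (EuclideanSpace ℂ α), Module.finrank ℂ V = n →
      ∃ v : Fin n → EuclideanSpace ℂ α, (∀ a, v a ∈ V) ∧ Orthonormal ℂ v ∧
        ∀ a b, a ≠ b → (v a).ofLp ⬝ᵥ (Z *ᵥ (v b).ofLp) = 0 := by
  induction n with
  | zero => exact fun V _ => ⟨fun a => a.elim0, fun a => a.elim0, ⟨fun a => a.elim0,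
      fun a => a.elim0⟩, fun a => a.elim0⟩
  | succ n ih =>
    intro V hV
    have hsymm : ∀ u w : EuclideanSpace ℂ α,
        u.ofLp ⬝ᵥ (Z *ᵥ w.ofLp) = w.ofLp ⬝ᵥ (Z *ᵥ u.ofLp) := by
      intro u w
      rw [dotProduct_mulVec, ← mulVec_transpose, hZ, dotProduct_comm]
    have hne : V ≠ ⊥ := by
      rintro rfl
      simp at hV
    obtain ⟨v, hvV, hv1, hv⟩ := exists_unit_forall_orthogonal Z hZ V hne
    have hle : Submodule.span ℂ {v} ≤ V := by
      rwa [Submodule.span_singleton_le_iff_mem]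
    have hfin := Submodule.finrank_add_inf_finrank_orthogonal hle
    rw [finrank_span_singleton (by rintro rfl; simp at hv1), hV] at hfin
    obtain ⟨w, hwV, hwo, hw⟩ := ih ((Submodule.span ℂ {v})ᗮ ⊓ V) (by omega)
    have hvw : ∀ a, inner ℂ v (w a) = 0 := fun a =>
      Submodule.mem_orthogonal_singleton_iff_inner_right.1 (hwV a).1
    refine ⟨Fin.cons v w, fun a => ?_, ⟨fun a => ?_, fun a b hab => ?_⟩, fun a b hab => ?_⟩
    · refine Fin.cases hvV (fun a => (hwV a).2) a
    · refine Fin.cases hv1 (fun a => hwo.1 a) a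
    · induction a using Fin.cases with
      | zero =>
        induction b using Fin.cases with
        | zero => exact absurd rfl hab
        | succ b => simpa using hvw b
      | succ a =>
        induction b using Fin.cases with
        | zero => simpa using inner_eq_zero_symm.1 (hvw a)
        | succ b => simpa using hwo.2 (fun h => hab (by rw [h]))
    · induction a using Fin.cases with
      | zero =>
        induction b using Fin.cases with
        | zero => exact absurd rfl hab
        | succ b => simpa using hv (w b) (hwV b).2 (hvw b)
      | succ a =>
        induction b using Fin.cases with
        | zero =>
          rw [hsymm]
          simpa using hv (w a) (hwV a).2 (hvw a)
        | succ b => simpa using hw a b (fun h => hab (by rw [h]))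

/-- Takagi's factorization of a complex symmetric matrix. -/
theorem exists_takagi (Z : Matrix α α ℂ) (hZ : Zᵀ = Z) :
    ∃ (V : Matrix α α ℂ) (d : α → ℂ), Vᴴ * V = 1 ∧ V * Vᴴ = 1 ∧ Vᵀ * Z * V = diagonal d := by
  obtain ⟨v, -, ho, hv⟩ := exists_orthonormal_diagonalizing Z hZ (Fintype.card α) ⊤ (by simp)
  let e := Fintype.equivFin α
  let V : Matrix α α ℂ := Matrix.of fun i a => v (e a) i
  have h1 : Vᴴ * V = 1 := by
    ext a b
    have := orthonormal_iff_ite.1 ho (e a) (e b)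
    rw [PiLp.inner_apply] at this
    rw [mul_apply, one_apply]
    simpa [V, mul_comm] using this
  refine ⟨V, fun a => (Vᵀ * Z * V) a a, h1, mul_eq_one_comm.1 h1, ?_⟩
  ext a b
  by_cases hab : a = b
  · subst hab; simp
  · rw [diagonal_apply_ne _ hab, Matrix.mul_assoc]
    exact hv (e a) (e b) (fun h => hab (e.injective h))

end

/-! ### Sign symmetry and the Gaussian range finder for one complex matrix -/

section
open Matrix

theorem PolyGrowth.conj {ι : Type*} [Fintype ι] [DecidableEq ι] {d : ℕ} {f : (ι → ℝ) → ℂ}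
    (h : PolyGrowth d f) : PolyGrowth d (fun G => star (f G)) := by
  obtain ⟨h1, c, hc, h2⟩ := h
  exact ⟨Complex.continuous_conj.comp h1, c, hc, fun G => by rw [norm_star]; exact h2 G⟩

theorem PolyGrowth.integrable_frobSq {ι β γ : Type*} [Fintype ι] [DecidableEq ι] [Fintype β]
    [Fintype γ] [DecidableEq β] [DecidableEq γ] {F : (ι → ℝ) → Matrix β γ ℂ}
    (h : ∀ i j, PolyGrowth 1 (fun G => F G i j)) :
    Integrable (fun G => frobSq (F G)) (stdNormalPi ι) := by
  have h1 : PolyGrowth 2 (fun G => ((F G)ᴴ * F G).trace) :=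
    PolyGrowth.trace (PolyGrowth.matrix_mul (F := fun G => (F G)ᴴ) (fun i j => (h j i).conj) h)
  refine h1.integrable.re.congr (Filter.Eventually.of_forall fun G => ?_)
  simp only [trace_conjTranspose_mul_self_eq_frobSq, RCLike.re_eq_complex_re, Complex.ofReal_re]

variable {ι κ α β : Type*} [Fintype ι] [Fintype κ] [Fintype α] [Fintype β]
  [DecidableEq ι] [DecidableEq κ] [DecidableEq α] [DecidableEq β]
  {W : Matrix ι α ℂ} {h : α → ℝ} {η : ℝ}

theorem gaussMat_orthogonal_mul (O : Matrix ι ι ℝ) (G : ι × κ → ℝ) :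
    gaussMat (fun e : ι × κ => ∑ j, O e.1 j * G (j, e.2))
      = O.map (fun x : ℝ => (x : ℂ)) * gaussMat G := by
  ext i a
  simp [gaussMat, mul_apply]

/-- Since `O` only changes signs of columns of `W`, it commutes with `W diag(h)⁻¹ Wᴴ`. Replacing `g`
by `O g` thus conjugates `R` by `O`, and conjugates the Gram matrix of `R W` by the signs. -/
theorem regInv_mul_orthogonal (hh : ∀ a, 0 < h a) (hη : 0 < η) {O : Matrix ι ι ℝ}
    (hO : Oᵀ * O = 1) {ε : α → ℂ} (hε : ∀ a, ε a * ε a = 1) (hε' : ∀ a, star (ε a) = ε a)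
    (hOW : O.map (fun x : ℝ => (x : ℂ)) * W = W * diagonal ε) (G : ι × κ → ℝ) :
    (regInv (gaussMat (fun e : ι × κ => ∑ j, O e.1 j * G (j, e.2))) W h η * W)ᴴ
        * (regInv (gaussMat (fun e : ι × κ => ∑ j, O e.1 j * G (j, e.2))) W h η * W)
      = diagonal ε * ((regInv (gaussMat G) W h η * W)ᴴ * (regInv (gaussMat G) W h η * W))
        * diagonal ε := by
  rw [gaussMat_orthogonal_mul]
  set g := gaussMat G with hg
  have hR := regGram_mul_regInv (W := W) (conjTranspose_gaussMat G) hh hη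
  have hRh := conjTranspose_regInv (W := W) (conjTranspose_gaussMat G) hh hη
  rw [← hg] at hR hRh
  set P : Matrix ι ι ℂ := O.map (fun x : ℝ => (x : ℂ)) with hP
  have hPP : Pᵀ * P = 1 := by
    have := congrArg (fun M : Matrix ι ι ℝ => M.map Complex.ofRealHom) hO
    simp only [Matrix.map_mul, Matrix.map_one _ (map_zero _) (map_one _)] at this
    exact this
  have hPP' : P * Pᵀ = 1 := mul_eq_one_comm.1 hPP
  have hPh : Pᴴ = Pᵀ := by ext i j; simp [hP]
  have hEE : diagonal ε * diagonal ε = (1 : Matrix α α ℂ) := by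
    rw [diagonal_mul_diagonal]; simp [hε]
  have hEh : (diagonal ε)ᴴ = diagonal ε := by
    rw [diagonal_conjTranspose]; congr 1; funext a; exact hε' a
  have hWP : Wᴴ * Pᵀ = diagonal ε * Wᴴ := by
    rw [← hPh, ← conjTranspose_mul, hOW, conjTranspose_mul, hEh]
  have hPW : Pᵀ * W = W * diagonal ε := by
    calc Pᵀ * W = Pᵀ * (W * (diagonal ε * diagonal ε)) := by rw [hEE, Matrix.mul_one]
      _ = Pᵀ * (P * W) * diagonal ε := by rw [hOW]; simp only [Matrix.mul_assoc]
      _ = _ := by rw [← Matrix.mul_assoc, hPP, Matrix.one_mul]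
  have hD : diagonal ε * (diagonal (fun a => ((h a)⁻¹ : ℂ)) * diagonal ε)
      = diagonal (fun a => ((h a)⁻¹ : ℂ)) := by
    rw [diagonal_mul_diagonal, diagonal_mul_diagonal]
    congr 1; funext a
    rw [mul_left_comm, hε, mul_one]
  have hM : regGram (P * g) W h η = P * regGram g W h η * Pᵀ := by
    unfold regGram
    simp only [Matrix.mul_add, Matrix.add_mul, transpose_mul, Matrix.mul_smul, Matrix.smul_mul,
      Matrix.mul_one, hPP', Matrix.mul_assoc, hWP]
    congr 1
    rw [← Matrix.mul_assoc P W, hOW, ← Matrix.mul_assoc (diagonal _) (diagonal _) Wᴴ,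
      Matrix.mul_assoc W, ← Matrix.mul_assoc (diagonal ε), hD]
  have hinv : regInv (P * g) W h η = P * regInv g W h η * Pᵀ := by
    conv_lhs => unfold regInv
    refine inv_eq_right_inv ?_
    rw [hM]
    calc P * regGram g W h η * Pᵀ * (P * regInv g W h η * Pᵀ)
        = P * regGram g W h η * (Pᵀ * P) * regInv g W h η * Pᵀ := by
          simp only [Matrix.mul_assoc]
      _ = P * (regGram g W h η * regInv g W h η) * Pᵀ := by
          rw [hPP, Matrix.mul_one]; simp only [Matrix.mul_assoc]
      _ = 1 := by rw [hR, Matrix.mul_one, hPP']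
  have hRW : regInv (P * g) W h η * W = P * (regInv g W h η * W) * diagonal ε := by
    rw [hinv, Matrix.mul_assoc, hPW]; simp only [Matrix.mul_assoc]
  rw [hRW, conjTranspose_mul, conjTranspose_mul P, hEh, hPh]
  calc diagonal ε * ((regInv g W h η * W)ᴴ * Pᵀ) * (P * (regInv g W h η * W) * diagonal ε)
      = diagonal ε * (regInv g W h η * W)ᴴ * (Pᵀ * P) * (regInv g W h η * W) * diagonal ε := by
        simp only [Matrix.mul_assoc]
    _ = _ := by rw [hPP, Matrix.mul_one]; simp only [Matrix.mul_assoc]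

theorem polyGrowth_regInv_mul_gram (hh : ∀ a, 0 < h a) (hη : 0 < η) (a b : α) :
    PolyGrowth 0 (fun G : ι × κ → ℝ =>
      ((regInv (gaussMat G) W h η * W)ᴴ * (regInv (gaussMat G) W h η * W)) a b) := by
  have p := PolyGrowth.matrix_mul_const W (polyGrowth_regInv (W := W) (κ := κ) hh hη)
  exact PolyGrowth.matrix_mul (d := 0) (d' := 0)
    (F := fun G => (regInv (gaussMat G) W h η * W)ᴴ) (fun i j => (p j i).conj) p a b

/-- The reflection fixing column `a` and negating column `b` preserves the law of `G` and flips the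
sign of this entry. -/
theorem integral_regInv_mul_gram_eq_zero (hh : ∀ a, 0 < h a) (hη : 0 < η) {d : α → ℂ}
    (hW : Wᴴ * W = 1) (hd : Wᵀ * W = diagonal d) {a b : α} (hab : a ≠ b) :
    ∫ G : ι × κ → ℝ, ((regInv (gaussMat G) W h η * W)ᴴ * (regInv (gaussMat G) W h η * W)) a b
      ∂(stdNormalPi (ι × κ)) = 0 := by
  obtain ⟨O, hO, hOW⟩ := exists_orthogonal_fix_column hW hd a
  have hT := measurePreserving_orthogonal_mul (κ := κ) O hO
  have p := polyGrowth_regInv_mul_gram (W := W) (κ := κ) hh hη a b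
  have e1 := integral_map hT.measurable.aemeasurable
    (p.1.aestronglyMeasurable (μ := Measure.map _ (stdNormalPi (ι × κ))))
  rw [hT.map_eq] at e1
  have e2 : ∀ G : ι × κ → ℝ,
      ((regInv (gaussMat (fun e : ι × κ => ∑ j, O e.1 j * G (j, e.2))) W h η * W)ᴴ
        * (regInv (gaussMat (fun e : ι × κ => ∑ j, O e.1 j * G (j, e.2))) W h η * W)) a b
      = -((regInv (gaussMat G) W h η * W)ᴴ * (regInv (gaussMat G) W h η * W)) a b := by
    intro G
    rw [regInv_mul_orthogonal hh hη hO (fun c => by split_ifs <;> simp)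
      (fun c => by split_ifs <;> simp) hOW G, mul_diagonal, diagonal_mul]
    simp [hab.symm]
  simp only [e2, integral_neg] at e1
  exact self_eq_neg.1 e1

/-- In mean only the terms `h_a⁻² N_aa K_aa` survive. One factor `h_a⁻¹ N_aa` is at most `c`, and
the remaining `∑ h_a⁻¹ K_aa` is part of the trace of `R`. -/
theorem integral_frobSq_mul_le (hh : ∀ a, 0 < h a) (hη : 0 < η) {d : α → ℂ}
    (hW : Wᴴ * W = 1) (hd : Wᵀ * W = diagonal d) (A : Matrix β ι ℂ) {c : ℝ} (hc : 0 ≤ c)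
    (hA : ∀ a, (h a)⁻¹ * ∑ i, ‖(A * W) i a‖ ^ 2 ≤ c) :
    ∫ G : ι × κ → ℝ, frobSq (A * (W * diagonal (fun a => ((h a)⁻¹ : ℂ)) * Wᴴ
        * regInv (gaussMat G) W h η)) ∂(stdNormalPi (ι × κ))
      ≤ c * ∫ G : ι × κ → ℝ, (regInv (gaussMat G) W h η).trace.re ∂(stdNormalPi (ι × κ)) := by
  let K : (ι × κ → ℝ) → Matrix α α ℂ := fun G =>
    (regInv (gaussMat G) W h η * W)ᴴ * (regInv (gaussMat G) W h η * W)
  let N : Matrix α α ℂ := (A * W)ᴴ * (A * W)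
  have hK : ∀ a b, Integrable (fun G => K G a b) (stdNormalPi (ι × κ)) := fun a b =>
    ((polyGrowth_regInv_mul_gram hh hη a b).mono (Nat.zero_le _)).integrable
  have h1 : ∀ G : ι × κ → ℝ, ((frobSq (A * (W * diagonal (fun a => ((h a)⁻¹ : ℂ)) * Wᴴ
        * regInv (gaussMat G) W h η)) : ℝ) : ℂ)
      = ∑ a, ∑ b, ((h a)⁻¹ : ℂ) * N a b * ((h b)⁻¹ : ℂ) * K G b a := by
    intro G
    have hRh := conjTranspose_regInv (W := W) (conjTranspose_gaussMat G) hh hη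
    have e1 : (∑ a, ∑ b, ((h a)⁻¹ : ℂ) * N a b * ((h b)⁻¹ : ℂ) * K G b a)
        = (diagonal (fun a => ((h a)⁻¹ : ℂ)) * N * diagonal (fun a => ((h a)⁻¹ : ℂ))
          * K G).trace := by
      simp only [trace, diag]
      refine Finset.sum_congr rfl fun a _ => ?_
      rw [mul_apply]
      refine Finset.sum_congr rfl fun b _ => ?_
      rw [mul_diagonal, diagonal_mul]
    have hDh : (diagonal (fun a => ((h a)⁻¹ : ℂ)))ᴴ = diagonal (fun a => ((h a)⁻¹ : ℂ)) := by
      rw [diagonal_conjTranspose]; congr 1; funext a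
      simp
    rw [e1, ← trace_conjTranspose_mul_self_eq_frobSq]
    simp only [K, N, conjTranspose_mul, hRh, hDh, conjTranspose_conjTranspose]
    rw [show ∀ X : Matrix α ι ℂ, ∀ D M : Matrix α α ℂ, ∀ R : Matrix ι ι ℂ,
      D * M * D * (X * R * (R * W)) = (D * M * D * X * R) * (R * W) from
      fun X D M R => by simp only [Matrix.mul_assoc], trace_mul_comm (_ * _) (_ * W)]
    simp only [Matrix.mul_assoc]
  have h2 : ∫ G : ι × κ → ℝ, ((frobSq (A * (W * diagonal (fun a => ((h a)⁻¹ : ℂ)) * Wᴴ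
        * regInv (gaussMat G) W h η)) : ℝ) : ℂ) ∂(stdNormalPi (ι × κ))
      = ∑ a, ((h a)⁻¹ : ℂ) * N a a * ((h a)⁻¹ : ℂ) * ∫ G, K G a a ∂(stdNormalPi (ι × κ)) := by
    simp only [h1]
    rw [integral_finsetSum _ fun a _ => integrable_finsetSum _ fun b _ => (hK b a).const_mul _]
    refine Finset.sum_congr rfl fun a _ => ?_
    rw [integral_finsetSum _ fun b _ => (hK b a).const_mul _, Finset.sum_eq_single a]
    · rw [integral_const_mul]
    · intro b _ hb
      rw [integral_const_mul, integral_regInv_mul_gram_eq_zero hh hη hW hd hb, mul_zero]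
    · simp
  let L : α → (ι × κ → ℝ) → ℝ := fun a G => ∑ i, ‖(regInv (gaussMat G) W h η * W) i a‖ ^ 2
  have hKL : ∀ a G, K G a a = ((L a G : ℝ) : ℂ) := fun a G =>
    conjTranspose_mul_self_apply_self _ a
  have hL : ∀ a, Integrable (L a) (stdNormalPi (ι × κ)) := fun a => by
    refine (hK a a).re.congr (Filter.Eventually.of_forall fun G => ?_)
    simp only [hKL, RCLike.re_eq_complex_re, Complex.ofReal_re]
  have h3 : ∫ G : ι × κ → ℝ, frobSq (A * (W * diagonal (fun a => ((h a)⁻¹ : ℂ)) * Wᴴ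
        * regInv (gaussMat G) W h η)) ∂(stdNormalPi (ι × κ))
      = ∑ a, ((h a)⁻¹ * ∑ i, ‖(A * W) i a‖ ^ 2) *
        ((h a)⁻¹ * ∫ G, L a G ∂(stdNormalPi (ι × κ))) := by
    rw [integral_complex_ofReal] at h2
    have e : ∀ a, ((h a)⁻¹ : ℂ) * N a a * ((h a)⁻¹ : ℂ) * ∫ G, K G a a ∂(stdNormalPi (ι × κ))
        = ((((h a)⁻¹ * ∑ i, ‖(A * W) i a‖ ^ 2) *
          ((h a)⁻¹ * ∫ G, L a G ∂(stdNormalPi (ι × κ))) : ℝ) : ℂ) := by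
      intro a
      simp only [hKL]
      rw [integral_complex_ofReal, show N a a = _ from conjTranspose_mul_self_apply_self _ a]
      push_cast
      ring
    simp only [e] at h2
    exact_mod_cast h2
  rw [h3]
  have hLnn : ∀ a, 0 ≤ ∫ G, L a G ∂(stdNormalPi (ι × κ)) := fun a =>
    integral_nonneg fun G => Finset.sum_nonneg fun _ _ => sq_nonneg _
  calc _ ≤ ∑ a, c * ((h a)⁻¹ * ∫ G, L a G ∂(stdNormalPi (ι × κ))) :=
        Finset.sum_le_sum fun a _ => mul_le_mul_of_nonneg_right (hA a)
          (mul_nonneg (inv_nonneg.2 (hh a).le) (hLnn a))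
    _ = c * ∫ G, ∑ a, (h a)⁻¹ * L a G ∂(stdNormalPi (ι × κ)) := by
        rw [integral_finsetSum _ fun a _ => (hL a).const_mul _, Finset.mul_sum]
        simp only [integral_const_mul]
    _ ≤ _ := by
        refine mul_le_mul_of_nonneg_left (integral_mono (integrable_finsetSum _ fun a _ =>
          (hL a).const_mul _) (integrable_trace_regInv_re hh hη) fun G => ?_) hc
        exact sum_inv_mul_le_re_trace_regInv (conjTranspose_gaussMat G) hh hη

theorem integral_frobSq_regInv_le (hh : ∀ a, 0 < h a) (hη : 0 < η) {d : α → ℂ}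
    (hW : Wᴴ * W = 1) (hd : Wᵀ * W = diagonal d) (A : Matrix β ι ℂ) {c : ℝ} (hc : 0 ≤ c)
    (hA : ∀ a, (h a)⁻¹ * ∑ i, ‖(A * W) i a‖ ^ 2 ≤ c) {ε : ℝ} (hε : 0 < ε) :
    Integrable (fun G : ι × κ → ℝ => frobSq (A * (1 - gaussMat G * ((gaussMat G)ᵀ
        * regInv (gaussMat G) W h η)))) (stdNormalPi (ι × κ)) ∧
    ∫ G : ι × κ → ℝ, frobSq (A * (1 - gaussMat G * ((gaussMat G)ᵀ
        * regInv (gaussMat G) W h η))) ∂(stdNormalPi (ι × κ))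
      ≤ ((1 + ε) * c + (1 + 1 / ε) * frobSq A * η) *
        ∫ G : ι × κ → ℝ, (regInv (gaussMat G) W h η).trace.re ∂(stdNormalPi (ι × κ)) := by
  have e1 : ∀ G : ι × κ → ℝ, A * (1 - gaussMat G * ((gaussMat G)ᵀ * regInv (gaussMat G) W h η))
      = A * (W * diagonal (fun a => ((h a)⁻¹ : ℂ)) * Wᴴ * regInv (gaussMat G) W h η)
        + (η : ℂ) • (A * regInv (gaussMat G) W h η) := by
    intro G
    rw [← Matrix.mul_assoc (gaussMat G),
      gram_mul_regInv (W := W) (conjTranspose_gaussMat G) hh hη, ← Matrix.mul_smul,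
      ← Matrix.mul_add]
    congr 1
    abel
  have pR := polyGrowth_regInv (W := W) (κ := κ) hh hη
  have p1 := PolyGrowth.const_matrix_mul A (PolyGrowth.const_matrix_mul
    (W * diagonal (fun a => ((h a)⁻¹ : ℂ)) * Wᴴ) pR)
  have p2 := PolyGrowth.const_matrix_mul A pR
  have i1 : Integrable (fun G : ι × κ → ℝ => frobSq (A * (1 - gaussMat G * ((gaussMat G)ᵀ
        * regInv (gaussMat G) W h η)))) (stdNormalPi (ι × κ)) := by
    refine PolyGrowth.integrable_frobSq fun i j => ?_
    simp only [e1, Matrix.add_apply, Matrix.smul_apply, smul_eq_mul]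
    refine ((p1 i j).add ?_).mono (Nat.zero_le _)
    simpa using (PolyGrowth.const (d := 0) (η : ℂ)).mul (p2 i j)
  refine ⟨i1, ?_⟩
  have i2 := PolyGrowth.integrable_frobSq fun i j => (p1 i j).mono zero_le_one
  have i3 := integrable_trace_regInv_re (W := W) (κ := κ) hh hη
  have i4 := (i2.const_mul (1 + ε)).add (i3.const_mul ((1 + 1 / ε) * frobSq A * η))
  refine (integral_mono i1 i4 fun G => ?_).trans ?_
  · simp only [e1, Pi.add_apply]
    refine (frobSq_add_le _ _ hε).trans (add_le_add le_rfl ?_)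
    rw [frobSq_smul, Complex.norm_real, Real.norm_eq_abs, sq_abs, mul_assoc, mul_assoc]
    refine mul_le_mul_of_nonneg_left ?_ (by positivity)
    have f1 := frobSq_mul_le A (regInv (gaussMat G) W h η)
    have f2 := eta_mul_frobSq_le (W := W) (conjTranspose_gaussMat G) hh hη
    calc η ^ 2 * frobSq (A * regInv (gaussMat G) W h η)
        ≤ η ^ 2 * (frobSq A * frobSq (regInv (gaussMat G) W h η)) :=
          mul_le_mul_of_nonneg_left f1 (sq_nonneg _)
      _ = frobSq A * η * (η * frobSq (regInv (gaussMat G) W h η)) := by ring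
      _ ≤ frobSq A * η * (regInv (gaussMat G) W h η).trace.re :=
          mul_le_mul_of_nonneg_left f2 (mul_nonneg (frobSq_nonneg _) hη.le)
      _ = _ := by ring
  · simp only [Pi.add_apply]
    rw [integral_add (i2.const_mul _) (i3.const_mul _), integral_const_mul, integral_const_mul,
      add_mul _ _ (∫ G : ι × κ → ℝ, (regInv (gaussMat G) W h η).trace.re ∂_),
      mul_assoc (1 + ε) c]
    have f3 := mul_le_mul_of_nonneg_left (integral_frobSq_mul_le (κ := κ) hh hη hW hd A hc hA)
      (by positivity : (0 : ℝ) ≤ 1 + ε)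
    linarith

/-- The order of the limits matters: `(τ + q ε) / ε`, the value of `∑ h`, blows up as `ε → 0`, so
`ε` is fixed first and `η` is chosen small depending on it. -/
theorem eventually_bound_lt {K a f q k s τ δ : ℝ} (hK : 0 < K) (hδ : 0 < δ) (ha : a = k * τ / K) :
    ∃ ε : ℝ, 0 < ε ∧ ∃ η : ℝ, 0 < η ∧ 0 < K - η * ((τ + q * ε) / ε) / 2 ∧
      ((1 + ε) * ε + (1 + 1 / ε) * f * η) *
        ((s + k * ((τ + q * ε) / ε)) / (K - η * ((τ + q * ε) / ε) / 2)) < a + δ := by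
  have h1 : Filter.Tendsto (fun ε : ℝ => (1 + ε) * (ε * s + k * (τ + q * ε)) / K)
      (nhdsWithin 0 (Set.Ioi 0)) (nhds ((1 + 0) * (0 * s + k * (τ + q * 0)) / K)) := by
    refine Filter.Tendsto.mono_left (Continuous.tendsto ?_ 0) nhdsWithin_le_nhds
    fun_prop
  have h2 : (1 + 0) * (0 * s + k * (τ + q * 0)) / K < a + δ := by
    rw [ha]; simp [hδ]
  obtain ⟨ε, hε1, hε⟩ := ((h1.eventually_lt_const h2).and self_mem_nhdsWithin).exists
  have hε0 : 0 < ε := hε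
  refine ⟨ε, hε0, ?_⟩
  set H := (τ + q * ε) / ε with hH
  have h3 : Filter.Tendsto (fun η : ℝ => K - η * H / 2) (nhdsWithin 0 (Set.Ioi 0))
      (nhds (K - 0 * H / 2)) :=
    Filter.Tendsto.mono_left (Continuous.tendsto (by fun_prop) 0) nhdsWithin_le_nhds
  have hK0 : K - 0 * H / 2 = K := by ring
  rw [hK0] at h3
  have h4 : Filter.Tendsto (fun η : ℝ => ((1 + ε) * ε + (1 + 1 / ε) * f * η))
      (nhdsWithin 0 (Set.Ioi 0)) (nhds ((1 + ε) * ε + (1 + 1 / ε) * f * 0)) :=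
    Filter.Tendsto.mono_left (Continuous.tendsto (by fun_prop) 0) nhdsWithin_le_nhds
  have h5 := h4.mul ((tendsto_const_nhds (x := s + k * H)).div h3 hK.ne')
  have h6 : ((1 + ε) * ε + (1 + 1 / ε) * f * 0) * ((s + k * H) / K) < a + δ := by
    refine lt_of_eq_of_lt ?_ hε1
    rw [hH]
    field_simp
    ring
  obtain ⟨η, ⟨hη1, hη2⟩, hη3⟩ := (((h5.eventually_lt_const h6).and
    (h3.eventually_const_lt hK)).and self_mem_nhdsWithin).exists
  exact ⟨η, hη3, hη2, hη1⟩

/-- Gaussian range finder, approximation form: if `W₀` has orthonormal columns spanning a subspace of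
codimension at most `s`, then some sketch-dependent `X` makes `A (1 - G X)` small on average. -/
theorem exists_integral_frobSq_le (A : Matrix β ι ℂ) (W₀ : Matrix ι α ℂ) (hW₀ : W₀ᴴ * W₀ = 1)
    {s : ℕ} (hs : Fintype.card ι ≤ Fintype.card α + s) (hκ : s + 1 < Fintype.card κ)
    {δ : ℝ} (hδ : 0 < δ) :
    ∃ X : (ι × κ → ℝ) → Matrix κ ι ℂ,
      Integrable (fun G : ι × κ → ℝ => frobSq (A * (1 - gaussMat G * X G)))
        (stdNormalPi (ι × κ)) ∧
      ∫ G : ι × κ → ℝ, frobSq (A * (1 - gaussMat G * X G)) ∂(stdNormalPi (ι × κ))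
        ≤ (1 + (s : ℝ) / ((Fintype.card κ : ℝ) - s - 1)) * frobSq (A * W₀) + δ := by
  -- Passing to `W₀ V` keeps the column space and `‖A W₀‖`, and makes `Wᵀ W` diagonal, as the sign
  -- symmetry requires.
  obtain ⟨V, d, hV1, hV2, hVd⟩ := exists_takagi (W₀ᵀ * W₀) (by simp)
  set W := W₀ * V with hWdef
  have hW : Wᴴ * W = 1 := by
    rw [hWdef, conjTranspose_mul]
    calc Vᴴ * W₀ᴴ * (W₀ * V) = Vᴴ * (W₀ᴴ * W₀) * V := by simp only [Matrix.mul_assoc]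
      _ = 1 := by rw [hW₀, Matrix.mul_one, hV1]
  have hd : Wᵀ * W = diagonal d := by
    rw [hWdef, transpose_mul, ← hVd]; simp only [Matrix.mul_assoc]
  have hAW : frobSq (A * W) = frobSq (A * W₀) := by
    have e : ∀ Z : Matrix ι α ℂ, ((frobSq (A * Z) : ℝ) : ℂ) = (A * (Z * Zᴴ) * Aᴴ).trace := by
      intro Z
      rw [← frobSq_conjTranspose, ← trace_conjTranspose_mul_self_eq_frobSq]
      simp only [conjTranspose_mul, conjTranspose_conjTranspose, Matrix.mul_assoc]
    have : W * Wᴴ = W₀ * W₀ᴴ := by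
      rw [hWdef, conjTranspose_mul]
      calc W₀ * V * (Vᴴ * W₀ᴴ) = W₀ * (V * Vᴴ) * W₀ᴴ := by simp only [Matrix.mul_assoc]
        _ = _ := by rw [hV2, Matrix.mul_one]
    have h2 := e W
    rw [this, ← e W₀] at h2
    exact_mod_cast h2
  have htr : (1 - W * Wᴴ).trace.re ≤ (s : ℝ) := by
    rw [trace_sub, trace_mul_comm, hW, trace_one, trace_one, Complex.sub_re, Complex.natCast_re,
      Complex.natCast_re]
    have : (Fintype.card ι : ℝ) ≤ Fintype.card α + s := by exact_mod_cast hs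
    linarith
  have hK : (0 : ℝ) < Fintype.card κ - 1 - s := by
    have : (s : ℝ) + 1 < Fintype.card κ := by exact_mod_cast hκ
    linarith
  obtain ⟨ε, hε, η, hη, hpos, hlt⟩ := eventually_bound_lt (f := frobSq A)
    (q := Fintype.card α) (s := s) hK hδ
    (rfl : ((Fintype.card κ : ℝ) - 1) * frobSq (A * W) / (Fintype.card κ - 1 - s) = _)
  let N : α → ℝ := fun a => ∑ i, ‖(A * W) i a‖ ^ 2
  have hN : ∀ a, 0 ≤ N a := fun a => Finset.sum_nonneg fun _ _ => sq_nonneg _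
  -- Chosen so that `N a / h a ≤ ε` uniformly while `ε * ∑ h` tends to `‖A W‖²`; the added `ε` keeps
  -- `h` positive where `N a = 0`.
  let h : α → ℝ := fun a => (N a + ε) / ε
  have hh : ∀ a, 0 < h a := fun a => div_pos (by linarith [hN a]) hε
  have hsum : ∑ a, h a = (frobSq (A * W) + Fintype.card α * ε) / ε := by
    simp only [h]
    rw [← Finset.sum_div, Finset.sum_add_distrib, frobSq, Finset.sum_comm]
    simp
  have hA : ∀ a, (h a)⁻¹ * ∑ i, ‖(A * W) i a‖ ^ 2 ≤ ε := fun a => by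
    rw [inv_mul_le_iff₀ (hh a)]
    simp only [h]
    rw [div_mul_cancel₀ _ hε.ne']
    have : 0 < ε := hε
    simp only [N]
    linarith
  obtain ⟨i1, b1⟩ := integral_frobSq_regInv_le (κ := κ) hh hη hW hd A hε.le hA hε
  refine ⟨fun G => (gaussMat G)ᵀ * regInv (gaussMat G) W h η, i1, b1.trans ?_⟩
  have b2 := integral_trace_regInv_le (κ := κ) hh hη hW hd htr (by omega)
  rw [hsum, mul_comm, ← le_div_iff₀ hpos] at b2
  refine (mul_le_mul_of_nonneg_left b2 (add_nonneg (by positivity)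
    (mul_nonneg (mul_nonneg (by positivity) (frobSq_nonneg _)) hη.le))).trans (hlt.le.trans ?_)
  rw [← hAW]
  refine add_le_add (le_of_eq ?_) le_rfl
  have h1 : (Fintype.card κ : ℝ) - s - 1 ≠ 0 := by
    have : (Fintype.card κ : ℝ) - s - 1 = Fintype.card κ - 1 - s := by ring
    rw [this]; exact hK.ne'
  have h2 : (Fintype.card κ : ℝ) - 1 - s ≠ 0 := hK.ne'
  field_simp
  ring

end

/-! ### Fourier slices and Parseval's identity -/

section
open Matrix

theorem sum_norm_sq_dft {p : ℕ} [NeZero p] (Φ : ZMod p → ℂ) :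
    ∑ t, ‖ZMod.dft Φ t‖ ^ 2 = p * ∑ t, ‖Φ t‖ ^ 2 := by
  have h1 : ∀ t, star (ZMod.dft Φ t) = ∑ j, ZMod.stdAddChar (t * j) * star (Φ j) := by
    intro t
    rw [ZMod.dft_apply, star_sum]
    refine Finset.sum_congr rfl fun j _ => ?_
    rw [smul_eq_mul, star_mul', AddChar.map_neg_eq_conj, Complex.star_def, Complex.conj_conj,
      mul_comm j t]
  have h2 : ∀ j, ∑ t, ZMod.stdAddChar (t * j) * ZMod.dft Φ t = p * Φ j := by
    intro j
    have h := ZMod.invDFT_apply (ZMod.dft Φ) j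
    rw [LinearEquiv.symm_apply_apply] at h
    have hp : (p : ℂ) ≠ 0 := Nat.cast_ne_zero.2 (NeZero.ne p)
    rw [h, smul_eq_mul, mul_inv_cancel_left₀ hp]
    rfl
  have h3 : ∑ t, star (ZMod.dft Φ t) * ZMod.dft Φ t = p * ∑ j, star (Φ j) * Φ j := by
    simp only [h1, Finset.sum_mul, Finset.mul_sum]
    rw [Finset.sum_comm]
    refine Finset.sum_congr rfl fun j _ => ?_
    rw [mul_left_comm, ← h2, Finset.mul_sum]
    refine Finset.sum_congr rfl fun t _ => ?_
    ring
  have h4 : ∀ z : ℂ, star z * z = ((‖z‖ ^ 2 : ℝ) : ℂ) := fun z => by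
    push_cast; rw [← Complex.conj_mul']; rfl
  simp only [h4] at h3
  exact_mod_cast h3

theorem sum_norm_sq_dft_symm {p : ℕ} [NeZero p] (Φ : ZMod p → ℂ) :
    ∑ t, ‖ZMod.dft.symm Φ t‖ ^ 2 = (p : ℝ)⁻¹ * ∑ t, ‖Φ t‖ ^ 2 := by
  have h := sum_norm_sq_dft (ZMod.dft.symm Φ)
  rw [LinearEquiv.apply_symm_apply] at h
  rw [h, inv_mul_cancel_left₀ (Nat.cast_ne_zero.2 (NeZero.ne p))]

namespace TSketch

variable {m n r k p : ℕ} [NeZero p]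

theorem fourierSlice_apply (A : Tensor m n p) (t : ZMod p) (i : Fin m) (j : Fin n) :
    fourierSlice A t i j = ∑ u, ZMod.stdAddChar (-(u * t)) * (A i j u : ℂ) := by
  simp only [fourierSlice, of_apply, ZMod.dft_apply, smul_eq_mul]

theorem fourierSlice_tProd (A : Tensor m r p) (B : Tensor r n p) (t : ZMod p) :
    fourierSlice (tProd A B) t = fourierSlice A t * fourierSlice B t := by
  ext i j
  rw [mul_apply]
  simp only [fourierSlice_apply]
  have h1 : ∀ u, tProd A B i j u = ∑ l, ∑ v, A i l (u - v) * B l j v := by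
    intro u
    simp only [tProd, fold, mul_apply, bcirc, unfold, of_apply]
    rw [Fintype.sum_prod_type, Finset.sum_comm]
  simp only [h1]
  push_cast
  simp only [Finset.mul_sum]
  rw [Finset.sum_comm]
  refine Finset.sum_congr rfl fun l _ => ?_
  rw [Finset.sum_comm]
  refine Finset.sum_congr rfl fun v _ => ?_
  rw [Finset.sum_mul]
  -- The shift `u ↦ u + v` decouples the circular convolution.
  rw [← Equiv.sum_comp (Equiv.addRight v)]
  refine Finset.sum_congr rfl fun u _ => ?_
  simp only [Equiv.coe_addRight, add_sub_cancel_right]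
  rw [show -((u + v) * t) = -(u * t) + -(v * t) by ring, AddChar.map_add_eq_mul]
  ring

theorem fourierSlice_tTranspose (A : Tensor m n p) (t : ZMod p) :
    fourierSlice (tTranspose A) t = (fourierSlice A t)ᴴ := by
  ext i j
  rw [conjTranspose_apply]
  simp only [fourierSlice_apply, tTranspose, star_sum, star_mul']
  rw [← Equiv.sum_comp (Equiv.neg _)]
  refine Finset.sum_congr rfl fun u _ => ?_
  simp only [Equiv.neg_apply, neg_neg]
  rw [AddChar.map_neg_eq_conj (ZMod.stdAddChar) (u * t), Complex.star_def, Complex.conj_conj,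
    Complex.conj_ofReal, neg_mul, neg_neg]

theorem fourierSlice_of_eq_zero {A : Tensor m n p} (h : ∀ i j t, t ≠ 0 → A i j t = 0)
    (t : ZMod p) : fourierSlice A t = Matrix.of fun i j => (A i j 0 : ℂ) := by
  ext i j
  rw [fourierSlice_apply, Finset.sum_eq_single 0]
  · simp
  · intro u _ hu
    simp [h i j u hu]
  · simp

theorem fourierSlice_tId (t : ZMod p) : fourierSlice (tId n p) t = 1 := by
  rw [fourierSlice_of_eq_zero (fun i j t ht => by simp [tId, ht])]
  ext i j
  simp only [tId, one_apply, and_true, of_apply]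
  split_ifs <;> simp

theorem fourierSlice_sub (A B : Tensor m n p) (t : ZMod p) :
    fourierSlice (A - B) t = fourierSlice A t - fourierSlice B t := by
  ext i j
  rw [Matrix.sub_apply]
  simp only [fourierSlice_apply, Pi.sub_apply, Complex.ofReal_sub, mul_sub,
    Finset.sum_sub_distrib]

theorem sum_norm_sq_fourierSlice (A : Tensor m n p) (i : Fin m) (j : Fin n) :
    ∑ t, ‖fourierSlice A t i j‖ ^ 2 = p * ∑ t, A i j t ^ 2 := by
  have := sum_norm_sq_dft (fun u => (A i j u : ℂ))
  simpa [fourierSlice] using this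

theorem frobeniusNorm_sq (A : Tensor m n p) :
    frobeniusNorm A ^ 2 = (p : ℝ)⁻¹ * ∑ t, frobSq (fourierSlice A t) := by
  have h : ∑ t, frobSq (fourierSlice A t) = p * ∑ i, ∑ j, ∑ t, A i j t ^ 2 := by
    simp only [frobSq]
    rw [Finset.sum_comm, Finset.mul_sum]
    refine Finset.sum_congr rfl fun i _ => ?_
    rw [Finset.sum_comm, Finset.mul_sum]
    exact Finset.sum_congr rfl fun j _ => sum_norm_sq_fourierSlice A i j
  rw [h, inv_mul_cancel_left₀ (Nat.cast_ne_zero.2 (NeZero.ne p)), frobeniusNorm, Real.sq_sqrt]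
  exact Finset.sum_nonneg fun _ _ => Finset.sum_nonneg fun _ _ => Finset.sum_nonneg fun _ _ =>
    sq_nonneg _

end TSketch

/-! ### Projections, index ranges and right singular bases -/

theorem frobSq_eq_add_of_conjTranspose_mul_self {ι κ μ : Type*} [Fintype ι] [Fintype κ]
    [Fintype μ] [DecidableEq ι] [DecidableEq κ] [DecidableEq μ] {Q : Matrix ι κ ℂ}
    (hQ : Qᴴ * Q = 1) (Z : Matrix ι μ ℂ) :
    frobSq Z = frobSq (Z - Q * Qᴴ * Z) + frobSq (Qᴴ * Z) := by
  have h : (Z - Q * Qᴴ * Z)ᴴ * (Z - Q * Qᴴ * Z) + (Qᴴ * Z)ᴴ * (Qᴴ * Z) = Zᴴ * Z := by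
    have h1 : Zᴴ * Q * Qᴴ * (Q * Qᴴ * Z) = Zᴴ * Q * Qᴴ * Z := by
      calc Zᴴ * Q * Qᴴ * (Q * Qᴴ * Z) = Zᴴ * Q * (Qᴴ * Q) * Qᴴ * Z := by
            simp only [Matrix.mul_assoc]
        _ = _ := by rw [hQ, Matrix.mul_one]
    simp only [conjTranspose_sub, conjTranspose_mul, conjTranspose_conjTranspose,
      Matrix.sub_mul, Matrix.mul_sub, ← Matrix.mul_assoc] at h1 ⊢
    rw [h1]
    abel
  have h2 := congrArg trace h
  simp only [trace_add, trace_conjTranspose_mul_self_eq_frobSq] at h2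
  exact_mod_cast h2.symm

/-- The projection onto a space containing the range of `A g` approximates `A` at least as well as
any `A g X`. -/
theorem frobSq_sub_proj_le {ι κ μ ν : Type*} [Fintype ι] [Fintype κ] [Fintype μ] [Fintype ν]
    [DecidableEq ι] [DecidableEq κ] [DecidableEq μ] [DecidableEq ν]
    {A : Matrix ι μ ℂ} {g : Matrix μ ν ℂ} {Q : Matrix ι κ ℂ} {R : Matrix κ ν ℂ}
    (hQ : Qᴴ * Q = 1) (hA : A * g = Q * R) (X : Matrix ν μ ℂ) :
    frobSq (A - Q * Qᴴ * A) ≤ frobSq (A * (1 - g * X)) := by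
  have h1 : A * (1 - g * X) - Q * Qᴴ * (A * (1 - g * X)) = A - Q * Qᴴ * A := by
    have h2 : Q * Qᴴ * (A * (g * X)) = A * (g * X) := by
      rw [← Matrix.mul_assoc A, hA]
      calc Q * Qᴴ * (Q * R * X) = Q * (Qᴴ * Q) * R * X := by simp only [Matrix.mul_assoc]
        _ = _ := by rw [hQ, Matrix.mul_one]
    rw [Matrix.mul_sub, Matrix.mul_one, Matrix.mul_sub, h2]
    abel
  have h3 := frobSq_eq_add_of_conjTranspose_mul_self hQ (A * (1 - g * X))
  rw [h1] at h3
  have := frobSq_nonneg (Qᴴ * (A * (1 - g * X)))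
  linarith

/-- The matrix argument indexes tails by columns, up to `n`, whereas tail energies stop at `min m
n`; the surplus terms vanish. -/
theorem sum_subtype_eq_sum_min {F : ℕ → ℝ} {m n s : ℕ} (hF : ∀ i, m ≤ i → F i = 0) :
    ∑ i : {i : Fin n // s ≤ i.val}, F i.1 = ∑ i : Fin (min m n) with s + 1 ≤ i.val + 1, F i := by
  have h1 : ∑ i : {i : Fin n // s ≤ i.val}, F i.1 = ∑ i : Fin n with s ≤ i.val, F i :=
    (Finset.sum_subtype (Finset.univ.filter fun i : Fin n => s ≤ i.val) (by simp)
      (fun i : Fin n => F i)).symm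
  rw [h1, Finset.sum_filter, Finset.sum_filter]
  simp only [Nat.add_le_add_iff_right]
  rw [Fin.sum_univ_eq_sum_range (fun i => if s ≤ i then F i else 0),
    Fin.sum_univ_eq_sum_range (fun i => if s ≤ i then F i else 0)]
  symm
  refine Finset.sum_subset (Finset.range_mono (min_le_right m n)) fun i h1 h2 => ?_
  have : m ≤ i := by
    simp only [Finset.mem_range, not_lt] at h1 h2
    omega
  simp [hF i this]

theorem exists_right_singular_basis {m n : ℕ} (A : Matrix (Fin m) (Fin n) ℂ) :
    ∃ U : Matrix (Fin n) (Fin n) ℂ, Uᴴ * U = 1 ∧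
      ∀ i, ∑ j, ‖(A * U) j i‖ ^ 2 = LinearMap.singularValues (Matrix.toEuclideanLin A) i ^ 2 := by
  set T := Matrix.toEuclideanLin A with hT
  have hn : Module.finrank ℂ (EuclideanSpace ℂ (Fin n)) = n := by simp
  let b := T.isSymmetric_adjoint_comp_self.eigenvectorBasis hn
  let U : Matrix (Fin n) (Fin n) ℂ := Matrix.of fun j i => b i j
  refine ⟨U, ?_, fun i => ?_⟩
  · ext i j
    have := orthonormal_iff_ite.1 b.orthonormal i j
    rw [PiLp.inner_apply] at this
    rw [mul_apply, one_apply]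
    simpa [U, mul_comm] using this
  · have h1 : ∀ j, (A * U) j i = T (b i) j := by
      intro j
      rw [hT, Matrix.toLpLin_apply]
      rfl
    have h2 : ∑ j, ‖(A * U) j i‖ ^ 2 = ‖T (b i)‖ ^ 2 := by
      rw [EuclideanSpace.norm_sq_eq]
      simp only [h1]
    rw [h2, T.sq_singularValues_fin hn i]
    have h3 := T.isSymmetric_adjoint_comp_self.apply_eigenvectorBasis hn i
    have h4 : inner ℂ (b i) ((LinearMap.adjoint T ∘ₗ T) (b i)) = ((‖T (b i)‖ ^ 2 : ℝ) : ℂ) := by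
      rw [LinearMap.comp_apply, LinearMap.adjoint_inner_right, inner_self_eq_norm_sq_to_K]
      simp
    rw [h3, inner_smul_right, inner_self_eq_norm_sq_to_K, b.orthonormal.1 i] at h4
    have h5 := congrArg Complex.re h4
    rw [Complex.ofReal_re] at h5
    rw [← h5]
    simp

theorem singularValues_toEuclideanLin_eq_zero {m n i : ℕ} (A : Matrix (Fin m) (Fin n) ℂ)
    (h : m ≤ i) : LinearMap.singularValues (Matrix.toEuclideanLin A) i = 0 := by
  rw [LinearMap.singularValues_eq_zero_iff_le_finrank_range]
  refine (Submodule.finrank_le _).trans ?_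
  simpa using h

end

/-! ### The error bound for tensors -/

section
open Matrix

namespace TSketch

variable {m n k p : ℕ} [NeZero p]

theorem IsPartiallyOrthogonal.fourierSlice {Q : Tensor m k p} (h : IsPartiallyOrthogonal Q)
    (t : ZMod p) : (fourierSlice Q t)ᴴ * fourierSlice Q t = 1 := by
  have := congrArg (fun T => TSketch.fourierSlice T t) h
  simpa only [fourierSlice_tProd, fourierSlice_tTranspose, fourierSlice_tId] using this

theorem fourierSlice_error (A : Tensor m n p) (Q : Tensor m k p) (t : ZMod p) :
    fourierSlice (A - tProd (tProd Q (tTranspose Q)) A) t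
      = fourierSlice A t - fourierSlice Q t * (fourierSlice Q t)ᴴ * fourierSlice A t := by
  rw [fourierSlice_sub, fourierSlice_tProd, fourierSlice_tProd, fourierSlice_tTranspose]

theorem continuous_error (A : Tensor m n p) :
    Continuous fun Q : Tensor m k p =>
      frobeniusNorm (A - tProd (tProd Q (tTranspose Q)) A) ^ 2 := by
  simp only [frobeniusNorm, tProd, fold, bcirc, unfold, tTranspose, mul_apply, of_apply,
    Pi.sub_apply]
  fun_prop

/-- Projecting never increases the norm; this deterministic bound is what makes the error
integrable. -/
theorem error_le (A : Tensor m n p) {Q : Tensor m k p} (hQ : IsPartiallyOrthogonal Q) :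
    frobeniusNorm (A - tProd (tProd Q (tTranspose Q)) A) ^ 2 ≤ frobeniusNorm A ^ 2 := by
  rw [frobeniusNorm_sq, frobeniusNorm_sq]
  refine mul_le_mul_of_nonneg_left (Finset.sum_le_sum fun t _ => ?_) (by positivity)
  rw [fourierSlice_error]
  have h := frobSq_eq_add_of_conjTranspose_mul_self (hQ.fourierSlice t) (fourierSlice A t)
  have := frobSq_nonneg ((fourierSlice Q t)ᴴ * fourierSlice A t)
  linarith

theorem error_le_of_isTQRFactor (A : Tensor m n p) {B : Tensor n k p} {Q : Tensor m k p}
    (hB : ∀ i j t, t ≠ 0 → B i j t = 0) (hQ : IsTQRFactor (tProd A B) Q)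
    (X : ZMod p → Matrix (Fin k) (Fin n) ℂ) :
    frobeniusNorm (A - tProd (tProd Q (tTranspose Q)) A) ^ 2
      ≤ (p : ℝ)⁻¹ * ∑ t, frobSq (fourierSlice A t *
          (1 - gaussMat (fun e : Fin n × Fin k => B e.1 e.2 0) * X t)) := by
  obtain ⟨hQ, R, -, hR⟩ := hQ
  rw [frobeniusNorm_sq]
  refine mul_le_mul_of_nonneg_left (Finset.sum_le_sum fun t _ => ?_) (by positivity)
  rw [fourierSlice_error]
  refine frobSq_sub_proj_le (R := fourierSlice R t) (hQ.fourierSlice t) ?_ (X t)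
  have := congrArg (fun T => fourierSlice T t) hR
  simp only [fourierSlice_tProd] at this
  rw [← this, fourierSlice_of_eq_zero hB]
  rfl

theorem IsGaussianTensor.map_eq {Ω : Type*} [MeasurableSpace Ω] {P : Measure Ω}
    [IsProbabilityMeasure P] {B : Ω → Tensor n k p} (hB : IsGaussianTensor P B) :
    AEMeasurable (fun ω (e : Fin n × Fin k) => B ω e.1 e.2 0) P ∧
      P.map (fun ω (e : Fin n × Fin k) => B ω e.1 e.2 0) = stdNormalPi (Fin n × Fin k) := by
  have hm : ∀ e : Fin n × Fin k, AEMeasurable (fun ω => B ω e.1 e.2 0) P :=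
    fun e => (hB.hasLaw e.1 e.2).aemeasurable
  refine ⟨aemeasurable_pi_lambda _ hm, ?_⟩
  rw [(iIndepFun_iff_map_fun_eq_pi_map hm).1 hB.indep, stdNormalPi]
  congr 1
  funext e
  exact (hB.hasLaw e.1 e.2).map_eq

section
variable {s : ℕ} {Ω : Type*} [MeasurableSpace Ω] {P : Measure Ω} [IsProbabilityMeasure P]
  {B : Ω → Tensor n k p} {Q : Ω → Tensor m k p}

theorem integrable_error (A : Tensor m n p) (hQmeas : AEMeasurable Q P)
    (hQ : ∀ᵐ ω ∂P, IsPartiallyOrthogonal (Q ω)) :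
    Integrable (fun ω => frobeniusNorm (A - tProd (tProd (Q ω) (tTranspose (Q ω))) A) ^ 2) P := by
  refine Integrable.mono' (integrable_const (frobeniusNorm A ^ 2))
    ((continuous_error A).measurable.comp_aemeasurable hQmeas).aestronglyMeasurable ?_
  filter_upwards [hQ] with ω hω
  rw [Real.norm_of_nonneg (sq_nonneg _)]
  exact error_le A hω

/-- The expected error is controlled by the tail of the Fourier slices with respect to arbitrary
orthonormal bases. -/
theorem integral_error_le (hs : s + 1 < k) (A : Tensor m n p) (hB : IsGaussianTensor P B)
    (hQmeas : AEMeasurable Q P) (hQ : ∀ᵐ ω ∂P, IsTQRFactor (tProd A (B ω)) (Q ω))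
    (U : ZMod p → Matrix (Fin n) (Fin n) ℂ) (hU : ∀ t, (U t)ᴴ * U t = 1) :
    ∫ ω, frobeniusNorm (A - tProd (tProd (Q ω) (tTranspose (Q ω))) A) ^ 2 ∂P
      ≤ (1 + (s : ℝ) / ((k : ℝ) - s - 1)) * ((p : ℝ)⁻¹ * ∑ t,
        ∑ i : {i : Fin n // s ≤ i.val}, ∑ j, ‖(fourierSlice A t * U t) j i‖ ^ 2) := by
  -- Dropping the first `s` basis vectors leaves a subspace of codimension at most `s` in each
  -- slice.
  let W : ZMod p → Matrix (Fin n) {i : Fin n // s ≤ i.val} ℂ := fun t =>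
    (U t).submatrix id Subtype.val
  have hW : ∀ t, (W t)ᴴ * W t = 1 := fun t => by
    ext i j
    have := congrFun (congrFun (hU t) i.1) j.1
    rw [mul_apply] at this
    rw [mul_apply]
    simpa [W, one_apply, Subtype.ext_iff] using this
  have hAW : ∀ t, ∑ i : {i : Fin n // s ≤ i.val}, ∑ j, ‖(fourierSlice A t * U t) j i‖ ^ 2
      = frobSq (fourierSlice A t * W t) := fun t => by
    rw [frobSq, Finset.sum_comm]
    rfl
  simp only [hAW]
  have hcard : Fintype.card (Fin n) ≤ Fintype.card {i : Fin n // s ≤ i.val} + s := by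
    have h1 := Fintype.card_subtype_compl (fun i : Fin n => s ≤ i.val)
    have h2 : Fintype.card {i : Fin n // ¬ s ≤ i.val} ≤ s := by
      have := Fintype.card_le_of_injective
        (fun i : {i : Fin n // ¬ s ≤ i.val} => (⟨i.1.val, not_le.1 i.2⟩ : Fin s))
        (fun i j h => by
          simp only [Fin.mk.injEq] at h
          exact Subtype.ext (Fin.ext h))
      simpa using this
    omega
  obtain ⟨hGm, hGl⟩ := hB.map_eq
  -- The comparison matrices `X` depend on `δ`, but the left-hand side does not, so `δ` can be sent
  -- to `0`.
  refine le_of_forall_pos_le_add fun δ hδ => ?_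
  have key := fun t => exists_integral_frobSq_le (κ := Fin k) (fourierSlice A t) (W t) (hW t)
    hcard (by simpa using hs) hδ
  choose X hX1 hX2 using key
  simp only [Fintype.card_fin] at hX2
  let F : ZMod p → (Fin n × Fin k → ℝ) → ℝ := fun t G =>
    frobSq (fourierSlice A t * (1 - gaussMat G * X t G))
  have hF1 : ∀ t, Integrable (fun ω => F t (fun e => B ω e.1 e.2 0)) P := fun t => by
    have := hX1 t
    rw [← hGl] at this
    exact this.comp_aemeasurable hGm
  have hF2 : ∀ t, ∫ ω, F t (fun e => B ω e.1 e.2 0) ∂P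
      = ∫ G, F t G ∂(stdNormalPi (Fin n × Fin k)) := fun t => by
    have := hX1 t
    rw [← hGl] at this ⊢
    exact (integral_map hGm this.1).symm
  have h1 : ∫ ω, frobeniusNorm (A - tProd (tProd (Q ω) (tTranspose (Q ω))) A) ^ 2 ∂P
      ≤ ∫ ω, (p : ℝ)⁻¹ * ∑ t, F t (fun e => B ω e.1 e.2 0) ∂P := by
    refine integral_mono_ae (integrable_error A hQmeas (hQ.mono fun ω h => h.1))
      ((integrable_finsetSum _ fun t _ => hF1 t).const_mul _) ?_
    filter_upwards [hQ, hB.eq_zero] with ω h1 h2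
    exact error_le_of_isTQRFactor A h2 h1 (fun t => X t fun e => B ω e.1 e.2 0)
  refine h1.trans ?_
  rw [integral_const_mul, integral_finsetSum _ fun t _ => hF1 t]
  simp only [hF2]
  have hp : (0 : ℝ) < p := Nat.cast_pos.2 (NeZero.pos p)
  calc (p : ℝ)⁻¹ * ∑ t, ∫ G, F t G ∂(stdNormalPi (Fin n × Fin k))
      ≤ (p : ℝ)⁻¹ * ∑ t, ((1 + (s : ℝ) / ((k : ℝ) - s - 1))
          * frobSq (fourierSlice A t * W t) + δ) :=
        mul_le_mul_of_nonneg_left (Finset.sum_le_sum fun t _ => hX2 t) (by positivity)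
    _ = _ := by
        rw [Finset.sum_add_distrib, ← Finset.mul_sum, Finset.sum_const, Finset.card_univ,
          ZMod.card, nsmul_eq_mul]
        field_simp

end

theorem tailEnergySq_eq (A : Tensor m n p) (s : ℕ) :
    tailEnergySq A (s + 1) = (p : ℝ)⁻¹ * ∑ t, ∑ i : {i : Fin n // s ≤ i.val},
      LinearMap.singularValues (Matrix.toEuclideanLin (fourierSlice A t)) i.1 ^ 2 := by
  rw [Finset.sum_comm, Finset.mul_sum]
  rw [sum_subtype_eq_sum_min (m := m) (F := fun i => (p : ℝ)⁻¹ * ∑ t,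
    LinearMap.singularValues (Matrix.toEuclideanLin (fourierSlice A t)) i ^ 2)
    (fun i hi => by simp [singularValues_toEuclideanLin_eq_zero _ hi])]
  rw [tailEnergySq]
  refine Finset.sum_congr rfl fun i _ => ?_
  rw [tSingularValue, Real.sq_sqrt (Finset.sum_nonneg fun _ _ => sq_nonneg _), singularTube,
    sum_norm_sq_dft_symm]
  simp

theorem diagTailSq_eq {S : Tensor m n p} (hS : IsFDiagonal S) (s : ℕ) :
    diagTailSq S (s + 1) = (p : ℝ)⁻¹ * ∑ t, ∑ i : {i : Fin n // s ≤ i.val},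
      ∑ j, ‖fourierSlice S t j i.1‖ ^ 2 := by
  let F : ℕ → ℝ := fun i => if h : i < m ∧ i < n then ∑ t, S ⟨i, h.1⟩ ⟨i, h.2⟩ t ^ 2 else 0
  have hF : ∀ i : Fin n, ∑ j, ∑ t, S j i t ^ 2 = F i := by
    intro i
    by_cases hi : i.val < m
    · rw [Finset.sum_eq_single ⟨i.val, hi⟩]
      · simp [F, hi]
      · intro j _ hj
        refine Finset.sum_eq_zero fun t _ => ?_
        rw [hS j i t (fun h => hj (Fin.ext h)), sq, zero_mul]
      · simp
    · simp only [F, hi, false_and, dif_neg, not_false_eq_true]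
      refine Finset.sum_eq_zero fun j _ => Finset.sum_eq_zero fun t _ => ?_
      rw [hS j i t (by omega), sq, zero_mul]
  have h1 : (p : ℝ)⁻¹ * ∑ t, ∑ i : {i : Fin n // s ≤ i.val}, ∑ j, ‖fourierSlice S t j i.1‖ ^ 2
      = ∑ i : {i : Fin n // s ≤ i.val}, F i.1 := by
    rw [Finset.sum_comm, Finset.mul_sum]
    refine Finset.sum_congr rfl fun i _ => ?_
    rw [Finset.sum_comm, ← hF]
    simp only [sum_norm_sq_fourierSlice]
    rw [← Finset.mul_sum, inv_mul_cancel_left₀ (Nat.cast_ne_zero.2 (NeZero.ne p))]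
  rw [h1, sum_subtype_eq_sum_min (m := m) (fun i hi => by simp [F, hi]), diagTailSq]
  refine Finset.sum_congr rfl fun i _ => ?_
  have hi := i.2
  simp only [lt_min_iff] at hi
  simp only [F, hi, and_self, dif_pos]
  rfl

/-- Slicewise `A V = U S` with `U` unitary, so corresponding columns of `A V` and `S` have equal
norms. No ordering of the tubes enters. -/
theorem IsTSVD.sum_norm_sq {A : Tensor m n p} {U : Tensor m m p} {S : Tensor m n p}
    {V : Tensor n n p} (h : IsTSVD A U S V) (t : ZMod p) (i : Fin n) :
    ∑ j, ‖(fourierSlice A t * fourierSlice V t) j i‖ ^ 2 = ∑ j, ‖fourierSlice S t j i‖ ^ 2 := by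
  obtain ⟨hU, hV, -, hA⟩ := h
  have hU1 : (fourierSlice U t)ᴴ * fourierSlice U t = 1 :=
    IsPartiallyOrthogonal.fourierSlice hU.1 t
  have hV1 : (fourierSlice V t)ᴴ * fourierSlice V t = 1 :=
    IsPartiallyOrthogonal.fourierSlice hV.1 t
  have h1 : fourierSlice A t * fourierSlice V t = fourierSlice U t * fourierSlice S t := by
    rw [hA, fourierSlice_tProd, fourierSlice_tProd, fourierSlice_tTranspose, Matrix.mul_assoc,
      hV1, Matrix.mul_one]
  have h2 : (fourierSlice A t * fourierSlice V t)ᴴ * (fourierSlice A t * fourierSlice V t)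
      = (fourierSlice S t)ᴴ * fourierSlice S t := by
    rw [h1, conjTranspose_mul, Matrix.mul_assoc, ← Matrix.mul_assoc _ _ (fourierSlice S t), hU1,
      Matrix.one_mul]
  have h3 := congrFun (congrFun h2 i) i
  rw [conjTranspose_mul_self_apply_self, conjTranspose_mul_self_apply_self] at h3
  exact_mod_cast h3

end TSketch

end

theorem theorem5p3 {m n k p s : ℕ} [NeZero p] (hs : s + 1 < k)
    (A : TSketch.Tensor m n p)
    {Ω : Type*} [MeasurableSpace Ω] (P : Measure Ω) [IsProbabilityMeasure P]
    (B : Ω → TSketch.Tensor n k p) (hB : TSketch.IsGaussianTensor P B)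
    (Q : Ω → TSketch.Tensor m k p) (hQmeas : AEMeasurable Q P)
    (hQ : ∀ᵐ ω ∂P, TSketch.IsTQRFactor (TSketch.tProd A (B ω)) (Q ω)) :
    Integrable (fun ω => TSketch.frobeniusNorm
      (A - TSketch.tProd (TSketch.tProd (Q ω) (TSketch.tTranspose (Q ω))) A) ^ 2) P ∧
    ∫ ω, TSketch.frobeniusNorm
      (A - TSketch.tProd (TSketch.tProd (Q ω) (TSketch.tTranspose (Q ω))) A) ^ 2 ∂P
        ≤ (1 + (s : ℝ) / ((k : ℝ) - s - 1)) * TSketch.tailEnergySq A (s + 1) ∧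
    ∀ (U : TSketch.Tensor m m p) (S : TSketch.Tensor m n p) (V : TSketch.Tensor n n p),
      TSketch.IsTSVD A U S V →
      ∫ ω, TSketch.frobeniusNorm
        (A - TSketch.tProd (TSketch.tProd (Q ω) (TSketch.tTranspose (Q ω))) A) ^ 2 ∂P
          ≤ (1 + (s : ℝ) / ((k : ℝ) - s - 1)) * TSketch.diagTailSq S (s + 1) := by
  -- Both bounds are instances of `TSketch.integral_error_le`: ordered right singular bases give the
  -- tail energy, and the slices of `V` give the T-SVD version.
  choose U hU hUσ using fun t => exists_right_singular_basis (TSketch.fourierSlice A t)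
  refine ⟨TSketch.integrable_error A hQmeas (hQ.mono fun ω h => h.1), ?_, fun U S V h => ?_⟩
  · refine (TSketch.integral_error_le hs A hB hQmeas hQ U hU).trans (le_of_eq ?_)
    simp only [hUσ, TSketch.tailEnergySq_eq]
  · refine (TSketch.integral_error_le hs A hB hQmeas hQ (TSketch.fourierSlice V)
      (TSketch.IsPartiallyOrthogonal.fourierSlice h.2.1.1)).trans (le_of_eq ?_)
    simp only [h.sum_norm_sq, TSketch.diagTailSq_eq h.2.2.1]
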